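/- Let $\mathbf C$ be a (strict) cubical $\omega$-category with connections in the sense of Al-Agl, Brown and Steiner: sets of $n$-cells $\mathbf C_n$ ($n\ge 0$), faces $\partial_i^\alpha$, degeneracies $\epsilon_i$, connections $\Gamma_i^\alpha$ ($\alpha=\pm$) and partial compositions $A\star_i B$, defined exactly when $\partial_i^+A=\partial_i^-B$. The connections are normalised so that $\partial_i^\alpha\Gamma_i^\alpha X=\partial_{i+1}^\alpha\Gamma_i^\alpha X=X$ and $\partial_i^{\alpha}\Gamma_i^{-\alpha}X=\partial_{i+1}^{\alpha}\Gamma_i^{-\alpha}X=\epsilon_i\partial_i^{\alpha}X$. For $A\in\mathbf C_n$ and $1\le i<n$, put $\psi_iA=\Gamma_i^+\partial_{i+1}^-A\star_{i+1}A\star_{i+1}\Gamma_i^-\partial_{i+1}^+A$. For $n\ge1$, the cell $A$ is *$R_1$-invertible* if there is $B\in\mathbf C_n$ with $A\star_1B=\epsilon_1\partial_1^-A$ and $B\star_1A=\epsilon_1\partial_1^+A$ (both composites being defined), and it is *invertible* if $\psi_1\psi_2\cdots\psi_{n-1}A$ is $R_1$-invertible. For $1\le i<n$, a cell $A\in\mathbf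 C_n$ is *$T_i$-invertible* if there is $B\in\mathbf C_n$ with $\partial_i^\alpha A=\partial_{i+1}^\alpha B$ and $\partial_{i+1}^\alpha A=\partial_i^\alpha B$ for $\alpha=\pm$, such that $$(\Gamma_i^+\partial_i^-B\star_iB)\star_{i+1}(A\star_i\Gamma_i^-\partial_i^+A)=\Gamma_i^-\partial_i^-A\star_i\Gamma_i^+\partial_i^+B$$ and the same equation holds with $A$ and $B$ exchanged. For $n\ge2$, let $\Box_{n-1}\mathbf C$ be the cubical $n$-category which agrees with $\mathbf C$ up to dimension $n-1$ and whose $n$-cells are the $n$-dimensional shells in $\mathbf C$, that is, the families $(S_j^\alpha)_{1\le j\le n,\ \alpha=\pm}$ of $(n-1)$-cells with $\partial_j^\alpha S_k^\beta=\partial_{k-1}^\beta S_j^\alpha$ for $j<k$. Its operations in dimension $n$ are as follows: $\partial_j^\alpha S=S_j^\alpha$; for $X\in\mathbf C_{n-1}$, $\epsilon_jX$ and $\Gamma_j^\alpha X$ are the families of the faces of the corresponding cells of $\mathbf C$; if $S_i^+=S'^-_i$, then $(S\star_iS')_i^-=S_i^-$, $(S\star_iS')_i^+=S'^+_i$, $(S\star_iS')_j^\alpha=S_j^\alpha\star_iS'^\alpha_j$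 for $j>i$ and $(S\star_iS')_j^\alpha=S_j^\alpha\star_{i-1}S'^\alpha_j$ for $j<i$. A cell $A\in\mathbf C_n$ *has a $T_i$-invertible shell* if its shell $(\partial_j^\alpha A)_{j,\alpha}$ is $T_i$-invertible in $\Box_{n-1}\mathbf C$ (same definition as above). **Proposition.** For every $n\ge2$, every $1\le i<n$ and every $A\in\mathbf C_n$, the cell $A$ is $T_i$-invertible if and only if $A$ is invertible and has a $T_i$-invertible shell. -/

import Mathlib

universe u

namespace Cubical

/-- For distinct indices `i`, `j` in `Fin (n+1)`, the index `i_j` in `Fin n`: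
it is `i` if `i < j` and `i - 1` if `i > j`. The companion `j^i` (which is `j` if `j < i` and
`j + 1` if `j ≥ i`) is Mathlib's `Fin.succAbove i j`. -/
def low {n : ℕ} (i j : Fin (n + 1)) (h : i ≠ j) : Fin n :=
  ⟨if (i : ℕ) < j then i else i - 1, by
    have h' : (i : ℕ) ≠ j := fun e => h (Fin.ext e)
    split_ifs <;> omega⟩

/-- A cubical `ω`-category (strict, with connections), after Al-Agl, Brown and Steiner.

* `Bool` encodes the signs: `false` is `-`, `true` is `+`, and `!α` is `-α`.
* Directions are numbered from `0`: the direction `k` of an `n`-cell, with `1 ≤ k ≤ n`, is the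
  element `k - 1` of `Fin n`.
* `face i α` is `∂_i^α`, `eps i` is the degeneracy `ε_i`, `conn i α` is the connection `Γ_i^α`,
  and `comp i A B h` is the composite `A ⋆_i B`, defined exactly when `∂_i^+ A = ∂_i^- B`.
* As usual for partial operations, a law between composites is imposed whenever the composites in
  it are defined. -/
structure CubicalOmegaCat where
  /-- the set of `n`-cells -/
  cell : ℕ → Type u
  face : ∀ {n : ℕ}, Fin (n + 1) → Bool → cell (n + 1) → cell n
  eps : ∀ {n : ℕ}, Fin (n + 1) → cell n → cell (n + 1)
  conn : ∀ {n : ℕ}, Fin (n + 1) → Bool → cell (n + 1) → cell (n + 2)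
  comp : ∀ {n : ℕ} (i : Fin (n + 1)) (A B : cell (n + 1)),
    face i true A = face i false B → cell (n + 1)
  -- faces
  face_face : ∀ {n : ℕ} (i j : Fin (n + 2)) (h : i ≠ j) (α β : Bool) (A : cell (n + 2)),
    face (low j i h.symm) α (face i β A) = face (low i j h) β (face j α A)
  -- faces of degeneracies
  face_eps_self : ∀ {n : ℕ} (i : Fin (n + 1)) (α : Bool) (A : cell n), face i α (eps i A) = A
  face_eps : ∀ {n : ℕ} (i j : Fin (n + 2)) (h : i ≠ j) (α : Bool) (A : cell (n + 1)),
    face i α (eps j A) = eps (low j i h.symm) (face (low i j h) α A)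
  -- faces of connections
  face_conn_self : ∀ {n : ℕ} (j : Fin (n + 1)) (α : Bool) (A : cell (n + 1)),
    face j.castSucc α (conn j α A) = A
  face_conn_self_succ : ∀ {n : ℕ} (j : Fin (n + 1)) (α : Bool) (A : cell (n + 1)),
    face j.succ α (conn j α A) = A
  face_conn_opp : ∀ {n : ℕ} (j : Fin (n + 1)) (α : Bool) (A : cell (n + 1)),
    face j.castSucc α (conn j (!α) A) = eps j (face j α A)
  face_conn_opp_succ : ∀ {n : ℕ} (j : Fin (n + 1)) (α : Bool) (A : cell (n + 1)),
    face j.succ α (conn j (!α) A) = eps j (face j α A)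
  /-- `∂_i^α Γ_{j+1}^β = Γ_j^β ∂_i^α` for `i < j + 1` -/
  face_conn_lt : ∀ {n : ℕ} (i : Fin (n + 2)) (j : Fin (n + 1)), i ≤ j.castSucc →
    ∀ (α β : Bool) (A : cell (n + 2)),
      face i.castSucc α (conn j.succ β A) = conn j β (face i α A)
  /-- `∂_{i+1}^α Γ_j^β = Γ_j^β ∂_i^α` for `i + 1 > j + 1` -/
  face_conn_gt : ∀ {n : ℕ} (i : Fin (n + 2)) (j : Fin (n + 1)), j.castSucc < i →
    ∀ (α β : Bool) (A : cell (n + 2)),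
      face i.succ α (conn j.castSucc β A) = conn j β (face i α A)
  -- relations between degeneracies and connections
  eps_eps : ∀ {n : ℕ} (i j : Fin (n + 1)), i ≤ j → ∀ A : cell n,
    eps i.castSucc (eps j A) = eps j.succ (eps i A)
  conn_conn : ∀ {n : ℕ} (i j : Fin (n + 1)), i < j → ∀ (α β : Bool) (A : cell (n + 1)),
    conn i.castSucc α (conn j β A) = conn j.succ β (conn i α A)
  conn_conn_self : ∀ {n : ℕ} (i : Fin (n + 1)) (α : Bool) (A : cell (n + 1)),
    conn i.succ α (conn i α A) = conn i.castSucc α (conn i α A)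
  conn_eps : ∀ {n : ℕ} (i j : Fin (n + 2)) (h : i ≠ j) (α : Bool) (A : cell (n + 1)),
    conn i α (eps j A) = eps (i.castSucc.succAbove j) (conn (low i j h) α A)
  conn_eps_self : ∀ {n : ℕ} (i : Fin (n + 1)) (α : Bool) (A : cell n),
    conn i α (eps i A) = eps i.castSucc (eps i A)
  -- faces of composites
  face_comp_neg : ∀ {n : ℕ} (i : Fin (n + 1)) (A B : cell (n + 1)) h,
    face i false (comp i A B h) = face i false A
  face_comp_pos : ∀ {n : ℕ} (i : Fin (n + 1)) (A B : cell (n + 1)) h,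
    face i true (comp i A B h) = face i true B
  face_comp : ∀ {n : ℕ} (i j : Fin (n + 2)) (hij : i ≠ j) (α : Bool) (A B : cell (n + 2)) h h',
    face i α (comp j A B h) = comp (low j i hij.symm) (face i α A) (face i α B) h'
  -- exchange, associativity and units
  exchange : ∀ {n : ℕ} (i j : Fin (n + 1)), i ≠ j → ∀ (A B C D : cell (n + 1)) hAB hCD hAC hBD h h',
    comp j (comp i A B hAB) (comp i C D hCD) h = comp i (comp j A C hAC) (comp j B D hBD) h'
  assoc : ∀ {n : ℕ} (i : Fin (n + 1)) (A B C : cell (n + 1)) hBC h hAB h',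
    comp i A (comp i B C hBC) h = comp i (comp i A B hAB) C h'
  comp_eps : ∀ {n : ℕ} (i : Fin (n + 1)) (A : cell (n + 1)) h,
    comp i A (eps i (face i true A)) h = A
  eps_comp_self : ∀ {n : ℕ} (i : Fin (n + 1)) (A : cell (n + 1)) h,
    comp i (eps i (face i false A)) A h = A
  -- degeneracies and connections of composites
  eps_comp : ∀ {n : ℕ} (i : Fin (n + 2)) (j : Fin (n + 1)) (A B : cell (n + 1)) h h',
    eps i (comp j A B h) = comp (i.succAbove j) (eps i A) (eps i B) h'
  conn_comp : ∀ {n : ℕ} (i j : Fin (n + 1)), i ≠ j → ∀ (α : Bool) (A B : cell (n + 1)) h h',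
    conn i α (comp j A B h) = comp (i.castSucc.succAbove j) (conn i α A) (conn i α B) h'
  /-- `Γ_i^- (A ⋆_i B) = (Γ_i^- A ⋆_i ε_{i+1} B) ⋆_{i+1} (ε_i B ⋆_i Γ_i^- B)` -/
  conn_neg_comp_self : ∀ {n : ℕ} (i : Fin (n + 1)) (A B : cell (n + 1)) h h₁ h₂ h₃,
    conn i false (comp i A B h) =
      comp i.succ (comp i.castSucc (conn i false A) (eps i.succ B) h₁)
        (comp i.castSucc (eps i.castSucc B) (conn i false B) h₂) h₃
  /-- `Γ_i^+ (A ⋆_i B) = (Γ_i^+ A ⋆_i ε_i A) ⋆_{i+1} (ε_{i+1} A ⋆_i Γ_i^+ B)` -/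
  conn_pos_comp_self : ∀ {n : ℕ} (i : Fin (n + 1)) (A B : cell (n + 1)) h h₁ h₂ h₃,
    conn i true (comp i A B h) =
      comp i.succ (comp i.castSucc (conn i true A) (eps i.castSucc A) h₁)
        (comp i.castSucc (eps i.succ A) (conn i true B) h₂) h₃
  /-- `Γ_i^+ A ⋆_i Γ_i^- A = ε_{i+1} A` -/
  conn_comp_conn : ∀ {n : ℕ} (i : Fin (n + 1)) (A : cell (n + 1)) h,
    comp i.castSucc (conn i true A) (conn i false A) h = eps i.succ A
  /-- `Γ_i^+ A ⋆_{i+1} Γ_i^- A = ε_i A` -/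
  conn_comp_conn_succ : ∀ {n : ℕ} (i : Fin (n + 1)) (A : cell (n + 1)) h,
    comp i.succ (conn i true A) (conn i false A) h = eps i.castSucc A

/-- The operations between the `(n+1)`-cells `X` and the `(n+2)`-cells `Y` of a cubical category
(of any dimension at least `n+2`). The `T_i`-invertibility of an `(n+2)`-cell involves nothing
else of the cubical category. -/
structure Layer (n : ℕ) (X Y : Type u) where
  face : Fin (n + 2) → Bool → Y → X
  eps : Fin (n + 2) → X → Y
  conn : Fin (n + 1) → Bool → X → Y
  comp : ∀ (i : Fin (n + 2)) (A B : Y), face i true A = face i false B → Y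

namespace Layer

variable {n : ℕ} {X Y : Type u}

/-- The equation
`(Γ_i^+ ∂_i^- B ⋆_i B) ⋆_{i+1} (A ⋆_i Γ_i^- ∂_i^+ A) = Γ_i^- ∂_i^- A ⋆_i Γ_i^+ ∂_i^+ B`
(all the composites in it being defined). -/
def TEquation (L : Layer n X Y) (i : Fin (n + 1)) (A B : Y) : Prop :=
  ∃ h₁ h₂ h₃ h₄,
    L.comp i.succ
        (L.comp i.castSucc (L.conn i true (L.face i.castSucc false B)) B h₁)
        (L.comp i.castSucc A (L.conn i false (L.face i.castSucc true A)) h₂) h₃ =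
      L.comp i.castSucc (L.conn i false (L.face i.castSucc false A))
        (L.conn i true (L.face i.castSucc true B)) h₄

/-- `B` is a `T_i`-inverse of `A`. -/
structure IsTInverse (L : Layer n X Y) (i : Fin (n + 1)) (A B : Y) : Prop where
  face_left : ∀ α, L.face i.castSucc α A = L.face i.succ α B
  face_right : ∀ α, L.face i.succ α A = L.face i.castSucc α B
  equation : L.TEquation i A B
  equation_symm : L.TEquation i B A

/-- `A` is `T_i`-invertible. -/
def TInvertible (L : Layer n X Y) (i : Fin (n + 1)) (A : Y) : Prop :=
  ∃ B, L.IsTInverse i A B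

end Layer

namespace CubicalOmegaCat

variable (C : CubicalOmegaCat.{u})

/-- The operations of `C` between `(n+1)`-cells and `(n+2)`-cells. -/
def layer (n : ℕ) : Layer n (C.cell (n + 1)) (C.cell (n + 2)) where
  face := C.face
  eps := C.eps
  conn := C.conn
  comp := C.comp

/-- The cell `A` is invertible for the composition `⋆_k`. -/
def RInvertible {n : ℕ} (k : Fin (n + 1)) (A : C.cell (n + 1)) : Prop :=
  ∃ B, ∃ h₁ h₂, C.comp k A B h₁ = C.eps k (C.face k false A) ∧
    C.comp k B A h₂ = C.eps k (C.face k true A)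

/-- The folding operation
`ψ_i A = Γ_i^+ ∂_{i+1}^- A ⋆_{i+1} A ⋆_{i+1} Γ_i^- ∂_{i+1}^+ A` on cells of dimension `n+1`,
for a direction `i` other than the last one. -/
def psi : ∀ {n : ℕ}, Fin n → C.cell (n + 1) → C.cell (n + 1)
  | 0, i, _ => i.elim0
  | _ + 1, i, A =>
    C.comp i.succ
      (C.comp i.succ (C.conn i true (C.face i.succ false A)) A (C.face_conn_self_succ i true _))
      (C.conn i false (C.face i.succ true A))
      ((C.face_comp_pos i.succ _ A _).trans (C.face_conn_self_succ i false _).symm)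

/-- The iterated folding `ψ_1 (ψ_2 (⋯ (ψ_n A)))` of a cell of dimension `n+1`. -/
def fold {n : ℕ} (A : C.cell (n + 1)) : C.cell (n + 1) :=
  (List.finRange n).foldr C.psi A

/-- Plain invertibility of a cell (of dimension at least one). -/
def Invertible {n : ℕ} (A : C.cell (n + 1)) : Prop :=
  C.RInvertible 0 (C.fold A)

/-- `T_i`-invertibility of a cell of dimension at least two. -/
def TInvertible {n : ℕ} (i : Fin (n + 1)) (A : C.cell (n + 2)) : Prop :=
  (C.layer n).TInvertible i A

/-- The `(n+2)`-dimensional shells of `C`: families `(A_i^α)` of `(n+1)`-cells with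
`∂_{i_j}^α A_j^β = ∂_{j_i}^β A_i^α` for `i ≠ j`. They are the top-dimensional cells of
the cubical `(n+2)`-category `□ tr_{n+1} C`, which agrees with `C` up to dimension `n+1`. -/
@[ext]
structure Shell (n : ℕ) where
  side : Fin (n + 2) → Bool → C.cell (n + 1)
  compat : ∀ (i j : Fin (n + 2)) (h : i ≠ j) (α β : Bool),
    C.face (low i j h) α (side j β) = C.face (low j i h.symm) β (side i α)

variable {C}

/-- The shell of an `(n+2)`-cell: the family of its faces. -/
def shell {n : ℕ} (A : C.cell (n + 2)) : C.Shell n where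
  side i α := C.face i α A
  compat i j h α β := (C.face_face i j h β α A).symm

theorem comp_congr {n : ℕ} {i i' : Fin (n + 1)} {A A' B B' : C.cell (n + 1)} (hi : i = i')
    (hA : A = A') (hB : B = B') (h : C.face i true A = C.face i false B)
    (h' : C.face i' true A' = C.face i' false B') : C.comp i A B h = C.comp i' A' B' h' := by
  subst hi hA hB
  rfl

theorem low_low {n : ℕ} (i j k : Fin (n + 2)) (hij : i ≠ j) (hik : i ≠ k) (hjk : j ≠ k)
    (h₁ : low i k hik ≠ low j k hjk) (h₂ : low i j hij ≠ low k j hjk.symm) :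
    low (low i k hik) (low j k hjk) h₁ = low (low i j hij) (low k j hjk.symm) h₂ := by
  simp only [low, Fin.ext_iff] at *
  grind

theorem low_ne {n : ℕ} (i j k : Fin (n + 1)) (hij : i ≠ j) (hik : i ≠ k) (hjk : j ≠ k) :
    low i k hik ≠ low j k hjk := by
  simp only [low] at *
  grind

theorem composable_face (C : CubicalOmegaCat.{u}) {n : ℕ} (i j : Fin (n + 2)) (h : i ≠ j)
    (α : Bool) (A B : C.cell (n + 2)) (hAB : C.face j true A = C.face j false B) :
    C.face (low j i h.symm) true (C.face i α A) =
      C.face (low j i h.symm) false (C.face i α B) := by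
  rw [C.face_face i j h, C.face_face i j h, hAB]

namespace Shell

variable {n : ℕ}

theorem composable (i : Fin (n + 2)) (A B : C.Shell n) (hAB : A.side i true = B.side i false)
    (j : Fin (n + 2)) (h : i ≠ j) (α : Bool) :
    C.face (low i j h) true (A.side j α) = C.face (low i j h) false (B.side j α) := by
  rw [A.compat, B.compat, hAB]

/-- The sides of the composite of two shells in direction `i`: the sides in direction `i` are
`A_i^-` and `B_i^+`, and the sides in a direction `j ≠ i` are `A_j^α ⋆_{i_j} B_j^α`. -/
def compSide (i : Fin (n + 2)) (A B : C.Shell n) (hAB : A.side i true = B.side i false)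
    (j : Fin (n + 2)) (α : Bool) : C.cell (n + 1) :=
  if h : i = j then (if α then B.side i true else A.side i false)
  else C.comp (low i j h) (A.side j α) (B.side j α) (composable i A B hAB j h α)

theorem compSide_compat (i : Fin (n + 2)) (A B : C.Shell n)
    (hAB : A.side i true = B.side i false) (j k : Fin (n + 2)) (h : j ≠ k) (α β : Bool) :
    C.face (low j k h) α (compSide i A B hAB k β) =
      C.face (low k j h.symm) β (compSide i A B hAB j α) := by
  unfold compSide
  by_cases hij : i = j
  · subst hij
    rw [dif_neg h, dif_pos rfl]
    cases α
    · rw [C.face_comp_neg, A.compat]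
      rfl
    · rw [C.face_comp_pos, B.compat]
      rfl
  by_cases hik : i = k
  · subst hik
    rw [dif_neg hij, dif_pos rfl]
    cases β
    · rw [C.face_comp_neg, A.compat]
      rfl
    · rw [C.face_comp_pos, B.compat]
      rfl
  rw [dif_neg hij, dif_neg hik]
  cases n with
  | zero =>
    have h₁ : (i : ℕ) ≠ j := fun e => hij (Fin.ext e)
    have h₂ : (i : ℕ) ≠ k := fun e => hik (Fin.ext e)
    have h₃ : (j : ℕ) ≠ k := fun e => h (Fin.ext e)
    omega
  | succ m =>
    have n₁ : low j k h ≠ low i k hik := low_ne j i k (Ne.symm hij) h hik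
    have n₂ : low k j h.symm ≠ low i j hij := low_ne k i j (Ne.symm hik) h.symm hij
    have e := low_low i j k hij hik h n₁.symm n₂.symm
    have c₁ := C.composable_face _ _ n₁ α _ _ (composable i A B hAB k hik β)
    have c₂ := C.composable_face _ _ n₂ β _ _ (composable i A B hAB j hij α)
    rw [C.face_comp _ _ n₁ α _ _ _ c₁, C.face_comp _ _ n₂ β _ _ _ c₂]
    exact comp_congr e (A.compat j k h α β) (B.compat j k h α β) _ _

/-- The composite `A ⋆_i B` of shells. -/
def comp (i : Fin (n + 2)) (A B : C.Shell n) (hAB : A.side i true = B.side i false) :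
    C.Shell n where
  side := compSide i A B hAB
  compat := compSide_compat i A B hAB

end Shell

variable (C)

/-- The operations between the `(n+1)`-cells and the `(n+2)`-cells of `□ tr_{n+1} C`. The
degeneracies and connections of an `(n+1)`-cell `A` are the shells of `ε_i A` and `Γ_i^α A`,
which the laws of `C` express through the cells of dimension at most `n+1`; see
`boxLayer_eps_self`, `boxLayer_eps_ne`, `boxLayer_conn_self`, `boxLayer_conn_opp` and
`boxLayer_conn_lt`, `boxLayer_conn_gt`. -/
def boxLayer (n : ℕ) : Layer n (C.cell (n + 1)) (C.Shell n) where
  face i α A := A.side i α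
  eps i A := shell (C.eps i A)
  conn i α A := shell (C.conn i α A)
  comp := Shell.comp

section Formulas

variable {n : ℕ}

theorem boxLayer_eps_self (i : Fin (n + 2)) (A : C.cell (n + 1)) (β : Bool) :
    ((C.boxLayer n).eps i A).side i β = A :=
  C.face_eps_self i β A

theorem boxLayer_eps_ne (i j : Fin (n + 2)) (h : j ≠ i) (A : C.cell (n + 1)) (β : Bool) :
    ((C.boxLayer n).eps i A).side j β = C.eps (low i j h.symm) (C.face (low j i h) β A) :=
  C.face_eps j i h β A

theorem boxLayer_conn_self (i : Fin (n + 1)) (A : C.cell (n + 1)) (α : Bool) :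
    ((C.boxLayer n).conn i α A).side i.castSucc α = A ∧
      ((C.boxLayer n).conn i α A).side i.succ α = A :=
  ⟨C.face_conn_self i α A, C.face_conn_self_succ i α A⟩

theorem boxLayer_conn_opp (i : Fin (n + 1)) (A : C.cell (n + 1)) (β : Bool) :
    ((C.boxLayer n).conn i (!β) A).side i.castSucc β = C.eps i (C.face i β A) ∧
      ((C.boxLayer n).conn i (!β) A).side i.succ β = C.eps i (C.face i β A) :=
  ⟨C.face_conn_opp i β A, C.face_conn_opp_succ i β A⟩

theorem boxLayer_conn_lt (j : Fin (n + 2)) (i : Fin (n + 1)) (h : j ≤ i.castSucc) (α β : Bool)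
    (A : C.cell (n + 2)) :
    ((C.boxLayer (n + 1)).conn i.succ α A).side j.castSucc β = C.conn i α (C.face j β A) :=
  C.face_conn_lt j i h β α A

theorem boxLayer_conn_gt (j : Fin (n + 2)) (i : Fin (n + 1)) (h : i.castSucc < j) (α β : Bool)
    (A : C.cell (n + 2)) :
    ((C.boxLayer (n + 1)).conn i.castSucc α A).side j.succ β = C.conn i α (C.face j β A) :=
  C.face_conn_gt j i h β α A

end Formulas

/-- `A` has a `T_i`-invertible shell: its shell is `T_i`-invertible in `□ tr_{n+1} C`. -/
def HasTInvertibleShell {n : ℕ} (i : Fin (n + 1)) (A : C.cell (n + 2)) : Prop :=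
  (C.boxLayer n).TInvertible i (shell A)

end CubicalOmegaCat

end Cubical

/-! Let `psT i A` be the transposed folding Γ_i^+∂_i^-A ⋆_i A ⋆_i Γ_i^-∂_i^+A (directions numbered
from 0). Two facts about it give the theorem.

First, A is T_i-invertible iff `psT i A` is invertible for ⋆_{i+1}. This involves only the
directions i and i+1, so it is proved in a double category with connections. Composing the
T-equation with a connection on each side in direction i turns its left side into the
⋆_{i+1}-composite of the foldings of B and A and its right side into a degenerate square, and
nothing is lost because the added connections can be cancelled (`tEq_iff`). Conversely an inverse of
the folding of A unfolds to a T-inverse of A (`exists_psiT_eq`).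

Second, invertibility of `psT i A` for ⋆_{i+1} is plain invertibility plus a condition on faces. Let
`PInv j` say that ψ_0⋯ψ_{j-1}A is invertible for ⋆_0. It holds for ε_k with k ≤ j and Γ_k with k <
j, and is stable under all compositions (`pInv_ep`, `pInv_cn`, `PInv.cp`). As A and `psT i A` are
composites of each other with connections and degeneracies, one is plainly invertible iff the other
is (`pInv_psT_iff`). Invertibility for ⋆_k implies `PInv j` for k ≤ j (`RInv.pInv`), and the
converse holds when the faces in the other directions are invertible (`PInv.rInv`). The passage
between ⋆_j and ⋆_{j+1} rests on the identity `psiT_psi`, by which ψ_jA is ⋆_j-invertible iff `psT j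
A` is ⋆_{j+1}-invertible.

Finally, the face of `psT i A` in direction i is degenerate, and in a direction other than i and i+1
it is the transposed folding of a face of A. A T_i-invertible shell makes that face of A
T-invertible, so its folding is invertible by the first fact (`facesInv_psT`). -/

namespace Cubical

/-! ### Double categories with connections -/

/-- An edge-symmetric double category with connections. The directions are numbered `1` and `2`;
the compositions are total functions, whose values matter on composable pairs only. -/
structure SquareCat (V E S : Type u) where
  src : E → V
  tgt : E → V
  one : V → E
  mul : E → E → E
  s1 : S → E
  t1 : S → E
  s2 : S → E
  t2 : S → E
  e1 : E → S
  e2 : E → S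
  gp : E → S
  gm : E → S
  c1 : S → S → S
  c2 : S → S → S
  src_one : ∀ v, src (one v) = v
  tgt_one : ∀ v, tgt (one v) = v
  src_mul : ∀ a b, tgt a = src b → src (mul a b) = src a
  tgt_mul : ∀ a b, tgt a = src b → tgt (mul a b) = tgt b
  mul_one : ∀ a v, tgt a = v → mul a (one v) = a
  one_mul : ∀ a v, src a = v → mul (one v) a = a
  mul_assoc : ∀ a b d, tgt a = src b → tgt b = src d → mul (mul a b) d = mul a (mul b d)
  src_s2 : ∀ A, src (s2 A) = src (s1 A)
  tgt_s1 : ∀ A, tgt (s1 A) = src (t2 A)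
  tgt_s2 : ∀ A, tgt (s2 A) = src (t1 A)
  tgt_t2 : ∀ A, tgt (t2 A) = tgt (t1 A)
  s1_e1 : ∀ a, s1 (e1 a) = a
  t1_e1 : ∀ a, t1 (e1 a) = a
  s2_e1 : ∀ a, s2 (e1 a) = one (src a)
  t2_e1 : ∀ a, t2 (e1 a) = one (tgt a)
  s2_e2 : ∀ a, s2 (e2 a) = a
  t2_e2 : ∀ a, t2 (e2 a) = a
  s1_e2 : ∀ a, s1 (e2 a) = one (src a)
  t1_e2 : ∀ a, t1 (e2 a) = one (tgt a)
  s1_gp : ∀ a, s1 (gp a) = one (src a)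
  s2_gp : ∀ a, s2 (gp a) = one (src a)
  t1_gp : ∀ a, t1 (gp a) = a
  t2_gp : ∀ a, t2 (gp a) = a
  s1_gm : ∀ a, s1 (gm a) = a
  s2_gm : ∀ a, s2 (gm a) = a
  t1_gm : ∀ a, t1 (gm a) = one (tgt a)
  t2_gm : ∀ a, t2 (gm a) = one (tgt a)
  s1_c1 : ∀ A B, t1 A = s1 B → s1 (c1 A B) = s1 A
  t1_c1 : ∀ A B, t1 A = s1 B → t1 (c1 A B) = t1 B
  s2_c1 : ∀ A B, t1 A = s1 B → s2 (c1 A B) = mul (s2 A) (s2 B)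
  t2_c1 : ∀ A B, t1 A = s1 B → t2 (c1 A B) = mul (t2 A) (t2 B)
  s2_c2 : ∀ A B, t2 A = s2 B → s2 (c2 A B) = s2 A
  t2_c2 : ∀ A B, t2 A = s2 B → t2 (c2 A B) = t2 B
  s1_c2 : ∀ A B, t2 A = s2 B → s1 (c2 A B) = mul (s1 A) (s1 B)
  t1_c2 : ∀ A B, t2 A = s2 B → t1 (c2 A B) = mul (t1 A) (t1 B)
  exch : ∀ A B A' B', t1 A = s1 B → t1 A' = s1 B' → t2 A = s2 A' → t2 B = s2 B' →
    c2 (c1 A B) (c1 A' B') = c1 (c2 A A') (c2 B B')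
  assoc1 : ∀ A B D, t1 A = s1 B → t1 B = s1 D → c1 (c1 A B) D = c1 A (c1 B D)
  assoc2 : ∀ A B D, t2 A = s2 B → t2 B = s2 D → c2 (c2 A B) D = c2 A (c2 B D)
  c1_e1 : ∀ A a, t1 A = a → c1 A (e1 a) = A
  e1_c1 : ∀ A a, s1 A = a → c1 (e1 a) A = A
  c2_e2 : ∀ A a, t2 A = a → c2 A (e2 a) = A
  e2_c2 : ∀ A a, s2 A = a → c2 (e2 a) A = A
  e1_mul : ∀ a b, tgt a = src b → e1 (mul a b) = c2 (e1 a) (e1 b)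
  e2_mul : ∀ a b, tgt a = src b → e2 (mul a b) = c1 (e2 a) (e2 b)
  e2_one : ∀ v, e2 (one v) = e1 (one v)
  gp_one : ∀ v, gp (one v) = e1 (one v)
  gm_one : ∀ v, gm (one v) = e1 (one v)
  gm_mul : ∀ a b, tgt a = src b →
    gm (mul a b) = c2 (c1 (gm a) (e2 b)) (c1 (e1 b) (gm b))
  gp_mul : ∀ a b, tgt a = src b →
    gp (mul a b) = c2 (c1 (gp a) (e1 a)) (c1 (e2 a) (gp b))
  gp_c1_gm : ∀ a, c1 (gp a) (gm a) = e2 a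
  gp_c2_gm : ∀ a, c2 (gp a) (gm a) = e1 a

set_option linter.unusedSimpArgs false

namespace SquareCat

variable {V E S : Type u} (D : SquareCat V E S)

attribute [local simp] src_one tgt_one src_mul tgt_mul mul_one one_mul src_s2 tgt_s1 tgt_s2 tgt_t2
  s1_e1 t1_e1 s2_e1 t2_e1 s2_e2 t2_e2 s1_e2 t1_e2 s1_gp s2_gp t1_gp t2_gp s1_gm s2_gm t1_gm t2_gm
  s1_c1 t1_c1 s2_c1 t2_c1 s2_c2 t2_c2 s1_c2 t1_c2 gp_one gm_one e2_one

/-- The same two-by-two array read along the other direction; these forms are the axioms of the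
transposed double category. -/
theorem gm_mul' (a b : E) (h : D.tgt a = D.src b) :
    D.gm (D.mul a b) = D.c1 (D.c2 (D.gm a) (D.e1 b)) (D.c2 (D.e2 b) (D.gm b)) := by
  rw [D.gm_mul a b h, D.exch] <;> simp [h]

theorem gp_mul' (a b : E) (h : D.tgt a = D.src b) :
    D.gp (D.mul a b) = D.c1 (D.c2 (D.gp a) (D.e2 a)) (D.c2 (D.e1 a) (D.gp b)) := by
  rw [D.gp_mul a b h, D.exch] <;> simp [h]

/-- The double category with the two directions exchanged. -/
def transpose : SquareCat V E S where
  src := D.src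
  tgt := D.tgt
  one := D.one
  mul := D.mul
  s1 := D.s2
  t1 := D.t2
  s2 := D.s1
  t2 := D.t1
  e1 := D.e2
  e2 := D.e1
  gp := D.gp
  gm := D.gm
  c1 := D.c2
  c2 := D.c1
  src_one := D.src_one
  tgt_one := D.tgt_one
  src_mul := D.src_mul
  tgt_mul := D.tgt_mul
  mul_one := D.mul_one
  one_mul := D.one_mul
  mul_assoc := D.mul_assoc
  src_s2 := by simp
  tgt_s1 := by simp
  tgt_s2 := by simp
  tgt_t2 := by simp
  s1_e1 := by simp
  t1_e1 := by simp
  s2_e1 := by simp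
  t2_e1 := by simp
  s2_e2 := by simp
  t2_e2 := by simp
  s1_e2 := by simp
  t1_e2 := by simp
  s1_gp := by simp
  s2_gp := by simp
  t1_gp := by simp
  t2_gp := by simp
  s1_gm := by simp
  s2_gm := by simp
  t1_gm := by simp
  t2_gm := by simp
  s1_c1 := D.s2_c2
  t1_c1 := D.t2_c2
  s2_c1 := D.s1_c2
  t2_c1 := D.t1_c2
  s2_c2 := D.s1_c1
  t2_c2 := D.t1_c1
  s1_c2 := D.s2_c1
  t1_c2 := D.t2_c1
  exch A B A' B' h₁ h₂ h₃ h₄ := (D.exch A A' B B' h₃ h₄ h₁ h₂).symm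
  assoc1 := D.assoc2
  assoc2 := D.assoc1
  c1_e1 := D.c2_e2
  e1_c1 := D.e2_c2
  c2_e2 := D.c1_e1
  e2_c2 := D.e1_c1
  e1_mul := D.e2_mul
  e2_mul := D.e1_mul
  e2_one v := (D.e2_one v).symm
  gp_one := by simp
  gm_one := by simp
  gm_mul := D.gm_mul'
  gp_mul := D.gp_mul'
  gp_c1_gm := D.gp_c2_gm
  gp_c2_gm := D.gp_c1_gm

/-! ### The two foldings of a square -/

/-- The folding of a square, whose faces in direction `2` are units. -/
def psi (A : S) : S := D.c2 (D.c2 (D.gp (D.s2 A)) A) (D.gm (D.t2 A))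

/-- The folding of a square, whose faces in direction `1` are units. -/
def psiT (A : S) : S := D.c1 (D.c1 (D.gp (D.s1 A)) A) (D.gm (D.t1 A))

theorem s1_psi (A : S) : D.s1 (D.psi A) = D.mul (D.s1 A) (D.t2 A) := by
  simp [psi]

theorem t1_psi (A : S) : D.t1 (D.psi A) = D.mul (D.s2 A) (D.t1 A) := by
  simp [psi]

theorem s2_psi (A : S) : D.s2 (D.psi A) = D.one (D.src (D.s1 A)) := by
  simp [psi]

theorem t2_psi (A : S) : D.t2 (D.psi A) = D.one (D.tgt (D.t1 A)) := by
  simp [psi]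

theorem psi_e1 (a : E) : D.psi (D.e1 a) = D.e1 a := by
  simp only [psi, s2_e1, t2_e1, gp_one, gm_one, ← e2_one]
  rw [D.e2_c2, D.c2_e2] <;> simp

theorem psi_e2 (a : E) : D.psi (D.e2 a) = D.e1 a := by
  simp only [psi, s2_e2, t2_e2]
  rw [D.c2_e2, D.gp_c2_gm]; simp

theorem psi_gp (a : E) : D.psi (D.gp a) = D.e1 a := by
  simp only [psi, s2_gp, t2_gp, gp_one, ← e2_one]
  rw [D.e2_c2, D.gp_c2_gm]; simp

theorem psi_gm (a : E) : D.psi (D.gm a) = D.e1 a := by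
  simp only [psi, s2_gm, t2_gm, gm_one, ← e2_one]
  rw [D.gp_c2_gm, D.c2_e2]; simp

/-- The connections of the composite faces split into two-by-two arrays, and exchange separates the
rows of A and of B. -/
theorem psi_c1 (A B : S) (h : D.t1 A = D.s1 B) :
    D.psi (D.c1 A B) =
      D.c1 (D.c2 (D.psi A) (D.e1 (D.t2 B))) (D.c2 (D.e1 (D.s2 A)) (D.psi B)) := by
  have h₁ : D.c2 (D.gp (D.mul (D.s2 A) (D.s2 B))) (D.c1 A B) =
      D.c1 (D.c2 (D.gp (D.s2 A)) A) (D.c2 (D.e1 (D.s2 A)) (D.c2 (D.gp (D.s2 B)) B)) := by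
    rw [D.gp_mul' _ _ (by simp [h]), D.c2_e2, D.exch, D.assoc2] <;> simp [h]
  simp only [psi]
  rw [D.s2_c1 _ _ h, D.t2_c1 _ _ h, h₁, D.gm_mul' _ _ (by simp [h]), D.e2_c2, D.exch, D.assoc2,
    D.assoc2, D.assoc2, D.assoc2, D.assoc2] <;> simp [h]

/-- The common face contributes `gm` to the folding of A and `gp` to that of B, and `gp` followed by
`gm` in direction 1 is degenerate. The cancellation needs the folding of B to come first: the order
of the factors is reversed. -/
theorem psi_c2 (A B : S) (h : D.t2 A = D.s2 B) :
    D.psi (D.c2 A B) =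
      D.c1 (D.c2 (D.e1 (D.s1 A)) (D.psi B)) (D.c2 (D.psi A) (D.e1 (D.t1 B))) := by
  have e₁ : D.c2 (D.e1 (D.s1 A)) (D.psi B) =
      D.c2 (D.e1 (D.s1 A)) (D.c2 (D.gp (D.s2 B)) (D.c2 B (D.gm (D.t2 B)))) := by
    simp only [psi]
    rw [D.assoc2 _ B] <;> simp
  have e₂ : D.c2 (D.psi A) (D.e1 (D.t1 B)) =
      D.c2 (D.c2 (D.gp (D.s2 A)) A) (D.c2 (D.gm (D.s2 B)) (D.e1 (D.t1 B))) := by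
    simp only [psi]
    rw [D.assoc2 (D.c2 _ A), h] <;> simp [h]
  have e₃ : D.c1 (D.c2 (D.gp (D.s2 B)) (D.c2 B (D.gm (D.t2 B))))
      (D.c2 (D.gm (D.s2 B)) (D.e1 (D.t1 B))) = D.c2 B (D.gm (D.t2 B)) := by
    rw [← D.exch, D.gp_c1_gm, D.c1_e1, D.e2_c2] <;> simp
  have e₄ : D.c1 (D.e1 (D.s1 A)) (D.c2 (D.gp (D.s2 A)) A) = D.c2 (D.gp (D.s2 A)) A :=
    D.e1_c1 _ _ (by simp)
  rw [e₁, e₂, ← D.exch, e₃, e₄]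
  · simp only [psi]
    rw [D.s2_c2 _ _ h, D.t2_c2 _ _ h, ← D.assoc2 _ A, D.assoc2 _ B] <;> simp [h]
  all_goals simp [h]

/-- A square is determined by its folding and its faces. -/
theorem unfold (A : S) :
    D.c1 (D.c1 (D.c2 (D.e1 (D.s1 A)) (D.gp (D.t2 A))) (D.psi A))
      (D.c2 (D.gm (D.s2 A)) (D.e1 (D.t1 A))) = A := by
  -- The new `gp` on the face `t2 A` cancels the `gm` inside the folding; the remaining `gp` on `s2
  -- A` is cancelled by the last factor in the same way.
  have e₁ : D.c1 (D.c2 (D.e1 (D.s1 A)) (D.gp (D.t2 A))) (D.psi A) =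
      D.c2 (D.c2 (D.gp (D.s2 A)) A) (D.e2 (D.t2 A)) := by
    simp only [psi]
    rw [← D.exch, D.gp_c1_gm, D.e1_c1] <;> simp
  rw [e₁, D.c2_e2, ← D.exch, D.gp_c1_gm, D.c1_e1, D.e2_c2] <;> simp

/-- The transposed folding makes the two connections added by `psi` degenerate, so they disappear
from the composite. -/
theorem psiT_psi (A : S) : D.psiT (D.psi A) = D.psiT A := by
  -- Since `psiT` is the `psi` of `D.transpose`, each rule for `psi` is available with the
  -- directions exchanged.
  have e : ∀ A B, D.t2 A = D.s2 B → D.psiT (D.c2 A B) =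
      D.c2 (D.c1 (D.psiT A) (D.e2 (D.t1 B))) (D.c1 (D.e2 (D.s1 A)) (D.psiT B)) :=
    D.transpose.psi_c1
  have ep : ∀ a, D.psiT (D.gp a) = D.e2 a := D.transpose.psi_gp
  have em : ∀ a, D.psiT (D.gm a) = D.e2 a := D.transpose.psi_gm
  have es : D.s1 (D.psiT A) = D.one (D.src (D.s2 A)) := D.transpose.s2_psi A
  have et : D.t1 (D.psiT A) = D.one (D.tgt (D.t2 A)) := D.transpose.t2_psi A
  have es2 : D.s2 (D.psiT A) = D.mul (D.s2 A) (D.t1 A) := D.transpose.s1_psi A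
  have et2 : D.t2 (D.psiT A) = D.mul (D.s1 A) (D.t2 A) := D.transpose.t1_psi A
  have h₁ : D.psiT (D.c2 (D.gp (D.s2 A)) A) = D.psiT A := by
    rw [e _ _ (by simp), ep, s1_gp, e2_one, D.e1_c1, ← D.e2_mul, D.e2_c2] <;> simp [es, es2]
  rw [psi, e _ _ (by simp), em, h₁, t1_gm, e2_one, D.c1_e1, ← D.e2_mul, D.c2_e2] <;>
    simp [et, et2]

/-! ### Invertible edges and squares -/

/-- `B` is inverse to `A` in direction `1`. -/
structure IsInv1 (A B : S) : Prop where
  ts : D.t1 A = D.s1 B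
  ts' : D.t1 B = D.s1 A
  eq : D.c1 A B = D.e1 (D.s1 A)
  eq' : D.c1 B A = D.e1 (D.t1 A)

/-- `b` is an inverse of the edge `a`. -/
structure IsInvE (a b : E) : Prop where
  ts : D.tgt a = D.src b
  ts' : D.tgt b = D.src a
  eq : D.mul a b = D.one (D.src a)
  eq' : D.mul b a = D.one (D.tgt a)

variable {D}

theorem IsInvE.symm {a b : E} (h : D.IsInvE a b) : D.IsInvE b a :=
  ⟨h.ts', h.ts, by rw [h.eq', h.ts], by rw [h.eq, h.ts']⟩

/-- This is the expansion of `gp` on the product a b, which is a unit. -/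
theorem IsInvE.gp_left {a b : E} (h : D.IsInvE a b) :
    D.c1 (D.gp a) (D.c2 (D.e1 a) (D.gp b)) = D.e1 (D.one (D.src a)) := by
  have h₁ := h.ts
  have h₂ := h.ts'
  have := D.gp_mul' a b h₁
  rw [D.c2_e2, h.eq, D.gp_one] at this
  · exact this.symm
  · simp

theorem IsInvE.gm_left {a b : E} (h : D.IsInvE a b) :
    D.c1 (D.c2 (D.gm a) (D.e1 b)) (D.gm b) = D.e1 (D.one (D.src a)) := by
  have h₁ := h.ts
  have h₂ := h.ts'
  have := D.gm_mul' a b h₁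
  rw [D.e2_c2, h.eq, D.gm_one] at this
  · exact this.symm
  · simp

theorem IsInvE.gp {a b : E} (h : D.IsInvE a b) :
    D.IsInv1 (D.gp a) (D.c2 (D.e1 a) (D.gp b)) := by
  have h₁ := h.ts
  have h₂ := h.ts'
  refine ⟨by simp [h₁], by simp [h₁, h.eq], by rw [h.gp_left]; simp, ?_⟩
  -- The other equation is the relation for b a, composed with `e1 a` on the left.
  have e := congrArg (D.c2 (D.e1 a)) h.symm.gp_left
  rw [← D.e2_one, D.c2_e2 _ _ (by simp [h₁])] at e
  rw [t1_gp]
  refine Eq.trans ?_ e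
  conv_rhs => rw [← D.c1_e1 (D.e1 a) a (by simp)]
  rw [D.exch] <;> try simp [h₁, h₂]
  rw [← D.assoc2, ← D.e1_mul, h.eq, ← D.e2_one, D.e2_c2] <;> simp [h₁, h₂]

theorem IsInvE.gm {a b : E} (h : D.IsInvE a b) :
    D.IsInv1 (D.gm a) (D.c2 (D.gm b) (D.e1 a)) := by
  have h₁ := h.ts
  have h₂ := h.ts'
  refine ⟨by simp [h₁, h₂, h.eq'], by simp [h₂], ?_, ?_⟩
  · have e := congrArg (fun x => D.c2 x (D.e1 a)) h.gm_left
    rw [← D.e2_one, D.e2_c2 _ _ (by simp)] at e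
    rw [s1_gm]
    refine Eq.trans ?_ e
    conv_rhs => rw [← D.e1_c1 (D.e1 a) a (by simp)]
    rw [D.exch] <;> try simp [h₁, h₂]
    rw [D.assoc2, ← D.e1_mul, h.eq', ← D.e2_one, D.c2_e2] <;> simp [h₁, h₂]
  · rw [h.symm.gm_left]; simp [h₁]

theorem IsInv1.symm {A B : S} (h : D.IsInv1 A B) : D.IsInv1 B A :=
  ⟨h.ts', h.ts, by rw [h.eq', h.ts], by rw [h.eq, h.ts']⟩

/-- Foldings in the two directions reverse invertibility. -/
theorem IsInv1.psiT_psi {A B : S} (h : D.IsInv1 (D.psi A) B) :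
    D.transpose.IsInv1 (D.psiT A) (D.psiT B) := by
  have e : ∀ A B, D.t1 A = D.s1 B → D.psiT (D.c1 A B) =
      D.c2 (D.c1 (D.e2 (D.s2 A)) (D.psiT B)) (D.c1 (D.psiT A) (D.e2 (D.t2 B))) :=
    D.transpose.psi_c2
  have e1 : ∀ a, D.psiT (D.e1 a) = D.e2 a := D.transpose.psi_e2
  have es : ∀ A, D.s1 (D.psiT A) = D.one (D.src (D.s2 A)) := D.transpose.s2_psi
  have et : ∀ A, D.t1 (D.psiT A) = D.one (D.tgt (D.t2 A)) := D.transpose.t2_psi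
  have es2 : ∀ A, D.s2 (D.psiT A) = D.mul (D.s2 A) (D.t1 A) := D.transpose.s1_psi
  have et2 : ∀ A, D.t2 (D.psiT A) = D.mul (D.s1 A) (D.t2 A) := D.transpose.t1_psi
  have hA := D.psiT_psi A
  have s2A := D.s2_psi A
  have t2A := D.t2_psi A
  -- Inverses keep unit faces in direction 2, as is seen on the faces of the equation A B = 1.
  have f : ∀ {A B : S} {v w : V}, D.IsInv1 A B → D.s2 A = D.one v → D.t2 A = D.one w →
      D.s2 B = D.one v ∧ D.t2 B = D.one w := by
    intro A B v w h hs ht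
    have k₁ := congrArg D.s2 h.eq
    have k₂ := congrArg D.t2 h.eq
    have hv : D.src (D.s1 A) = v := by rw [← D.src_s2, hs, D.src_one]
    have hw : D.tgt (D.s1 A) = w := by rw [D.tgt_s1, ht, D.src_one]
    have hv' : D.src (D.s1 B) = v := by rw [← h.ts, ← D.tgt_s2, hs, D.tgt_one]
    have hw' : D.src (D.t2 B) = w := by rw [← D.tgt_s1, ← h.ts, ← D.tgt_t2, ht, D.tgt_one]
    rw [D.s2_c1 _ _ h.ts, hs, D.one_mul _ _ (by simp [hv']), s2_e1, hv] at k₁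
    rw [D.t2_c1 _ _ h.ts, ht, D.one_mul _ _ (by simp [hw']), t2_e1, hw] at k₂
    exact ⟨k₁, k₂⟩
  -- On squares whose faces in direction 2 are units, the whiskers in the rule for `psiT` of a
  -- `c1`-composite vanish, so `psiT` carries `c1` to `c2` in reverse order.
  have key : ∀ {A B : S} {v w : V}, D.IsInv1 A B → D.s2 A = D.one v → D.t2 A = D.one w →
      D.c2 (D.psiT B) (D.psiT A) = D.e2 (D.s1 A) := by
    intro A B v w h hs ht
    obtain ⟨hs', ht'⟩ := f h hs ht
    have k := e _ _ h.ts
    rw [h.eq, e1, hs, ht', e2_one, e2_one, D.e1_c1, D.c1_e1] at k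
    · exact k.symm
    · simp [et, ht]
    · simp [es, hs']
  have s2B := (f h s2A t2A).1
  have t2B := (f h s2A t2A).2
  have k₁ : D.t2 (D.psiT (D.psi A)) = D.s1 (D.psi A) := by
    rw [et2, t2A, D.mul_one]; simp [D.s1_psi]
  have k₂ : D.s2 (D.psiT (D.psi A)) = D.t1 (D.psi A) := by
    rw [es2, s2A, D.one_mul]; simp [D.t1_psi]
  have k₃ : D.t2 (D.psiT B) = D.s1 B := by
    rw [et2, t2B, D.mul_one]; simp [← h.ts, D.t1_psi]
  have k₄ : D.s2 (D.psiT B) = D.t1 B := by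
    rw [es2, s2B, D.one_mul]; simp [h.ts', D.s1_psi]
  rw [← hA]
  refine ⟨?_, ?_, ?_, ?_⟩
  · exact k₁.trans (h.ts'.symm.trans k₄.symm)
  · exact k₃.trans (h.ts.symm.trans k₂.symm)
  · exact (key h.symm s2B t2B).trans (by rw [← h.ts, ← k₂]; rfl)
  · exact (key h s2A t2A).trans (by rw [← k₁]; rfl)

/-! ### T-invertibility as invertibility of the transposed folding -/

variable (D)

/-- A degenerate square on a unit can be put beside P, after which exchange applies. -/
theorem c1_c2_whisker (P X Q : S) (v : V) (hX : D.s1 X = D.one v) (hP : D.s2 P = D.one v)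
    (h₁ : D.t1 P = D.s1 Q) (h₂ : D.t2 X = D.s2 Q) :
    D.c1 P (D.c2 X Q) = D.c2 X (D.c1 P Q) := by
  conv_lhs => rw [← D.e2_c2 P _ hP]
  rw [← D.exch, e2_one, D.e1_c1] <;> simp [*]

theorem c2_c1_whisker (P X Q : S) (v : V) (hQ : D.t1 Q = D.one v) (hP : D.t2 P = D.one v)
    (h₁ : D.t1 X = D.s1 P) (h₂ : D.t2 X = D.s2 Q) :
    D.c1 (D.c2 X Q) P = D.c2 (D.c1 X P) Q := by
  conv_lhs => rw [← D.c2_e2 P _ hP]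
  rw [← D.exch, e2_one, D.c1_e1] <;> simp [*]

/-- Recovers Q from its composite with `gp`: the added `gm` completes the `gp` to a degenerate
square. -/
theorem gp_c1_cancel (Q : S) :
    D.c2 (D.c1 (D.gp (D.s1 Q)) Q) (D.c1 (D.gm (D.s1 Q)) (D.e2 (D.t2 Q))) = Q := by
  rw [D.exch, D.gp_c2_gm, D.c2_e2, D.e1_c1] <;> simp

theorem c1_gm_cancel (Q : S) :
    D.c2 (D.c1 (D.e2 (D.s2 Q)) (D.gp (D.t1 Q))) (D.c1 Q (D.gm (D.t1 Q))) = Q := by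
  rw [D.exch, D.gp_c2_gm, D.e2_c2, D.c1_e1] <;> simp

/-- The equation of `T`-invertibility. -/
def TEq (A B : S) : Prop :=
  D.c2 (D.c1 (D.gp (D.s1 B)) B) (D.c1 A (D.gm (D.t1 A))) =
    D.c1 (D.gm (D.s1 A)) (D.gp (D.t1 B))

/-- `B` is a `T`-inverse of `A`. -/
structure IsT (A B : S) : Prop where
  s1_eq : D.s1 A = D.s2 B
  t1_eq : D.t1 A = D.t2 B
  s2_eq : D.s2 A = D.s1 B
  t2_eq : D.t2 A = D.t1 B
  eq : D.TEq A B
  eq' : D.TEq B A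

theorem s1_psiT (A : S) : D.s1 (D.psiT A) = D.one (D.src (D.s2 A)) := D.transpose.s2_psi A
theorem t1_psiT (A : S) : D.t1 (D.psiT A) = D.one (D.tgt (D.t2 A)) := D.transpose.t2_psi A
theorem s2_psiT (A : S) : D.s2 (D.psiT A) = D.mul (D.s2 A) (D.t1 A) := D.transpose.s1_psi A
theorem t2_psiT (A : S) : D.t2 (D.psiT A) = D.mul (D.s1 A) (D.t2 A) := D.transpose.t1_psi A

/-- The outer `gm` is stripped by `c1_gm_cancel`, then the `gp` by `gp_c1_cancel`; both recipes
depend only on the faces, which agree. -/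
theorem c1_gp_gm_cancel {Q Q' : S} (hs : D.s1 Q = D.s1 Q') (ht : D.t1 Q = D.t1 Q')
    (hs2 : D.s2 Q = D.s2 Q') (ht2 : D.t2 Q = D.t2 Q')
    (h : D.c1 (D.c1 (D.gp (D.s1 Q)) Q) (D.gm (D.t1 Q)) =
      D.c1 (D.c1 (D.gp (D.s1 Q')) Q') (D.gm (D.t1 Q'))) : Q = Q' := by
  have e₁ := D.c1_gm_cancel (D.c1 (D.gp (D.s1 Q)) Q)
  have e₂ := D.c1_gm_cancel (D.c1 (D.gp (D.s1 Q')) Q')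
  have e : D.c1 (D.gp (D.s1 Q)) Q = D.c1 (D.gp (D.s1 Q')) Q' := by
    rw [← e₁, ← e₂]
    simp only [t1_c1, t1_gp, s2_c1, s2_gp, hs, hs2, ht]
    rw [← h, hs, ht]
  rw [← D.gp_c1_cancel Q, ← D.gp_c1_cancel Q', e, hs, ht2]

/-- The connections `gp (s1 A)` and `gm (t1 B)` of the foldings have unit sides, so they slide out
of the composite; what stays inside is the left side of the T-equation. -/
theorem psiT_c2_psiT (A B : S) (h₂ : D.t1 A = D.t2 B)
    (h₃ : D.s2 A = D.s1 B) (h₄ : D.t2 A = D.t1 B) :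
    D.c2 (D.psiT B) (D.psiT A) =
      D.c1 (D.c1 (D.gp (D.s1 A)) (D.c2 (D.c1 (D.gp (D.s1 B)) B) (D.c1 A (D.gm (D.t1 A)))))
        (D.gm (D.t1 B)) := by
  have g₁ := D.tgt_s1 A
  have g₂ := D.tgt_s2 A
  have g₃ := D.src_s2 A
  have g₄ := D.tgt_t2 A
  have k₁ : D.src (D.s1 B) = D.src (D.s1 A) := by rw [← h₃, g₃]
  have k₂ : D.tgt (D.s1 B) = D.src (D.t1 A) := by rw [← h₃, g₂]
  have k₃ : D.src (D.t1 B) = D.tgt (D.s1 A) := by rw [← h₄, ← g₁]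
  have k₄ : D.tgt (D.t1 B) = D.tgt (D.t1 A) := by rw [← h₄, g₄]
  rw [D.c1_c2_whisker _ _ _ (D.src (D.s1 A)), D.c2_c1_whisker _ _ _ (D.tgt (D.t1 B)),
    ← D.assoc1]
  · rfl
  all_goals simp [← h₂, ← h₃, ← h₄, k₁, k₂, k₃, k₄]

/-- Both sides of the T-equation are framed by `gp (s1 A)` and `gm (t1 B)`. The framing is
reversible by `c1_gp_gm_cancel`, so the framed equation is equivalent to the original one. -/
theorem tEq_iff (A B : S) (h₁ : D.s1 A = D.s2 B) (h₂ : D.t1 A = D.t2 B) (h₃ : D.s2 A = D.s1 B)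
    (h₄ : D.t2 A = D.t1 B) :
    D.TEq A B ↔ D.c2 (D.psiT B) (D.psiT A) = D.e2 (D.t2 (D.psiT A)) := by
  have g₁ := D.tgt_s1 A
  have g₂ := D.tgt_s2 A
  have g₃ := D.src_s2 A
  have g₄ := D.tgt_t2 A
  have k₁ : D.src (D.s1 B) = D.src (D.s1 A) := by rw [← h₃, g₃]
  have k₂ : D.tgt (D.s1 B) = D.src (D.t1 A) := by rw [← h₃, g₂]
  have k₃ : D.src (D.t1 B) = D.tgt (D.s1 A) := by rw [← h₄, ← g₁]
  have k₄ : D.tgt (D.t1 B) = D.tgt (D.t1 A) := by rw [← h₄, g₄]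
  -- The framed right side is two pairs `gp`, `gm`, each collapsing to an `e2`.
  have hR : D.c1 (D.c1 (D.gp (D.s1 A)) (D.c1 (D.gm (D.s1 A)) (D.gp (D.t1 B)))) (D.gm (D.t1 B)) =
      D.e2 (D.t2 (D.psiT A)) := by
    rw [← D.assoc1, D.gp_c1_gm, D.assoc1, D.gp_c1_gm, t2_psiT, D.e2_mul, h₄] <;> simp [k₃]
  rw [D.psiT_c2_psiT A B h₂ h₃ h₄, ← hR, TEq]
  refine ⟨fun h => by rw [h], fun h => ?_⟩
  apply D.c1_gp_gm_cancel
  · simp [← h₁, ← h₂, ← h₃, ← h₄, k₁, k₂, k₃, k₄]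
  · simp [← h₁, ← h₂, ← h₃, ← h₄, k₁, k₂, k₃, k₄]
  · simp [← h₁, ← h₂, ← h₃, ← h₄, k₁, k₂, k₃, k₄]
  · simp [← h₁, ← h₂, ← h₃, ← h₄, k₁, k₂, k₃, k₄]
  · convert h using 3 <;> simp [← h₁, ← h₂, ← h₃, ← h₄, k₁, k₂, k₃, k₄]

theorem IsT.isInv2 {A B : S} (h : D.IsT A B) :
    D.transpose.IsInv1 (D.psiT A) (D.psiT B) := by
  obtain ⟨h₁, h₂, h₃, h₄, e, e'⟩ := h
  have k₁ : D.t2 (D.psiT A) = D.s2 (D.psiT B) := by simp [t2_psiT, s2_psiT, *]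
  have k₂ : D.t2 (D.psiT B) = D.s2 (D.psiT A) := by simp [t2_psiT, s2_psiT, *]
  refine ⟨k₁, k₂, ?_, ?_⟩
  · exact ((D.tEq_iff B A h₃.symm h₄.symm h₁.symm h₂.symm).1 e').trans (by rw [k₂]; rfl)
  · exact (D.tEq_iff A B h₁ h₂ h₃ h₄).1 e

/-- The square with given faces and folding. -/
theorem exists_psiT_eq (F : S) (x y z w : E) (hxz : D.tgt x = D.src z) (hyw : D.tgt y = D.src w)
    (hs : D.s2 F = D.mul x z) (ht : D.t2 F = D.mul y w) (hs' : D.s1 F = D.one (D.src x))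
    (ht' : D.t1 F = D.one (D.tgt w)) :
    ∃ B, D.s2 B = x ∧ D.s1 B = y ∧ D.t1 B = z ∧ D.t2 B = w ∧ D.psiT B = F := by
  have kx : D.src x = D.src y := by
    have := D.tgt_s1 F
    rw [hs', ht] at this
    simpa [hyw] using this
  have kz : D.tgt z = D.tgt w := by
    have := D.tgt_s2 F
    rw [hs, ht'] at this
    simpa [hxz] using this
  -- The witness is the formula of `unfold` in the transposed double category, with F in place of
  -- the folding.
  have f₁ : D.s1 (D.c2 (D.c2 (D.c1 (D.e2 x) (D.gp z)) F) (D.c1 (D.gm y) (D.e2 w))) = y := by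
    simp (maxDischargeDepth := 6) [*]
  have f₂ : D.t1 (D.c2 (D.c2 (D.c1 (D.e2 x) (D.gp z)) F) (D.c1 (D.gm y) (D.e2 w))) = z := by
    simp (maxDischargeDepth := 6) [*]
  refine ⟨D.c2 (D.c2 (D.c1 (D.e2 x) (D.gp z)) F) (D.c1 (D.gm y) (D.e2 w)),
    by simp (maxDischargeDepth := 6) [*], f₁, f₂, by simp (maxDischargeDepth := 6) [*], ?_⟩
  rw [psiT, f₁, f₂, D.c1_c2_whisker _ _ _ (D.src y), ← D.assoc1, D.gp_c1_gm, ← D.e2_mul, D.c2_e2,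
    D.c2_c1_whisker _ _ _ (D.tgt w), D.assoc1, D.gp_c1_gm, ← D.e2_mul, D.e2_c2] <;> simp (maxDischargeDepth := 6) [*]

/-- The faces of F are forced by those of `psiT A`, and they are the ones needed to unfold F to a
square with the faces of A exchanged. -/
theorem IsInv1.exists_isT {A F : S} (h : D.transpose.IsInv1 (D.psiT A) F) : ∃ B, D.IsT A B := by
  obtain ⟨h₁, h₂, e, e'⟩ := h
  change D.t2 (D.psiT A) = D.s2 F at h₁
  change D.t2 F = D.s2 (D.psiT A) at h₂
  change D.c2 (D.psiT A) F = D.e2 (D.s2 (D.psiT A)) at e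
  change D.c2 F (D.psiT A) = D.e2 (D.t2 (D.psiT A)) at e'
  have k₁ := congrArg D.s1 e
  have k₂ := congrArg D.t1 e
  have v₁ : D.src (D.s1 F) = D.src (D.s1 A) := by
    rw [← D.src_s2, ← h₁, t2_psiT]; simp
  have v₂ : D.src (D.t1 F) = D.tgt (D.t1 A) := by
    rw [← D.tgt_s2, ← h₁, t2_psiT]; simp
  rw [D.s1_c2 _ _ h₁, s1_psiT, D.one_mul _ _ (by simp [v₁])] at k₁
  rw [D.t1_c2 _ _ h₁, t1_psiT, D.one_mul _ _ (by simp [v₂])] at k₂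
  obtain ⟨B, b₁, b₂, b₃, b₄, rfl⟩ := D.exists_psiT_eq F (D.s1 A) (D.s2 A) (D.t2 A) (D.t1 A)
    (by simp) (by simp) (by rw [← h₁, t2_psiT]) (by rw [h₂, s2_psiT])
    (by rw [k₁]; simp [s2_psiT]) (by rw [k₂]; simp [s2_psiT])
  refine ⟨B, b₁.symm, b₄.symm, b₂.symm, b₃.symm, ?_, ?_⟩
  · exact (D.tEq_iff _ _ b₁.symm b₄.symm b₂.symm b₃.symm).2 e'
  · exact (D.tEq_iff _ _ b₂ b₃ b₁ b₄).2 (by rw [h₂]; exact e)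

end SquareCat

/-! ### Cubical operations indexed by natural numbers -/

theorem low_of_lt {n : ℕ} {i j : Fin (n + 1)} (h : i ≠ j) (hij : (i : ℕ) < j) :
    low i j h = ⟨i, by omega⟩ := by
  simp [low, hij]

theorem low_of_gt {n : ℕ} {i j : Fin (n + 1)} (h : i ≠ j) (hij : (j : ℕ) < i) :
    low i j h = ⟨i - 1, by omega⟩ := by
  simp [low, Nat.not_lt.2 hij.le]

namespace CubicalOmegaCat

variable (C : CubicalOmegaCat.{u}) {n : ℕ}

/-- The face operation, with a natural number for the direction. -/
def fc (k : ℕ) (α : Bool) (A : C.cell (n + 1)) : C.cell n := C.face (Fin.ofNat (n + 1) k) α A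

/-- The degeneracy, with a natural number for the direction. -/
def ep (k : ℕ) (A : C.cell n) : C.cell (n + 1) := C.eps (Fin.ofNat (n + 1) k) A

/-- The connection, with a natural number for the direction. -/
def cn (k : ℕ) (α : Bool) (A : C.cell (n + 1)) : C.cell (n + 2) :=
  C.conn (Fin.ofNat (n + 1) k) α A

open Classical in
/-- The composition, with a natural number for the direction, extended to a total function. -/
noncomputable def cp (k : ℕ) (A B : C.cell (n + 1)) : C.cell (n + 1) :=
  if h : C.fc k true A = C.fc k false B then C.comp (Fin.ofNat (n + 1) k) A B h else A

theorem ofNat_eq {k : ℕ} (h : k < n + 1) : Fin.ofNat (n + 1) k = ⟨k, h⟩ :=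
  Fin.ext (Nat.mod_eq_of_lt h)

theorem fc_eq {k : ℕ} (h : k < n + 1) (α : Bool) (A : C.cell (n + 1)) :
    C.fc k α A = C.face ⟨k, h⟩ α A := by
  rw [fc, ofNat_eq h]

theorem ep_eq {k : ℕ} (h : k < n + 1) (A : C.cell n) : C.ep k A = C.eps ⟨k, h⟩ A := by
  rw [ep, ofNat_eq h]

theorem cn_eq {k : ℕ} (h : k < n + 1) (α : Bool) (A : C.cell (n + 1)) :
    C.cn k α A = C.conn ⟨k, h⟩ α A := by
  rw [cn, ofNat_eq h]

theorem cp_eq {k : ℕ} (h : k < n + 1) (A B : C.cell (n + 1))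
    (hAB : C.face ⟨k, h⟩ true A = C.face ⟨k, h⟩ false B) :
    C.cp k A B = C.comp ⟨k, h⟩ A B hAB := by
  have : C.fc k true A = C.fc k false B := by rw [fc_eq C h, fc_eq C h, hAB]
  rw [cp, dif_pos this]
  exact comp_congr (ofNat_eq h) rfl rfl _ _

theorem cp_eq' (i : Fin (n + 1)) (A B : C.cell (n + 1)) (hAB : C.face i true A = C.face i false B) :
    C.comp i A B hAB = C.cp i A B := (C.cp_eq i.2 A B hAB).symm

theorem fc_eq' (i : Fin (n + 1)) (α : Bool) (A : C.cell (n + 1)) :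
    C.face i α A = C.fc i α A := (C.fc_eq i.2 α A).symm

theorem cn_eq' (i : Fin (n + 1)) (α : Bool) (A : C.cell (n + 1)) :
    C.conn i α A = C.cn i α A := (C.cn_eq i.2 α A).symm

variable {k l : ℕ} {α β : Bool}

theorem fc_fc (hkl : k ≤ l) (hl : l ≤ n) (A : C.cell (n + 2)) :
    C.fc k α (C.fc (l + 1) β A) = C.fc l β (C.fc k α A) := by
  have h : (⟨l + 1, by omega⟩ : Fin (n + 2)) ≠ ⟨k, by omega⟩ := by simp; omega
  have := C.face_face _ _ h α β A
  rw [low_of_lt, low_of_gt] at this <;> try (simp only []; omega)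
  rw [C.fc_eq (by omega), C.fc_eq (by omega), C.fc_eq (by omega), C.fc_eq (by omega)]
  exact this

theorem fc_ep_self (hk : k ≤ n) (A : C.cell n) : C.fc k α (C.ep k A) = A := by
  rw [C.fc_eq (by omega), C.ep_eq (by omega), C.face_eps_self]

theorem fc_ep_lt (hkl : k ≤ l) (hl : l ≤ n) (A : C.cell (n + 1)) :
    C.fc k α (C.ep (l + 1) A) = C.ep l (C.fc k α A) := by
  have h : (⟨k, by omega⟩ : Fin (n + 2)) ≠ ⟨l + 1, by omega⟩ := by simp; omega
  have := C.face_eps _ _ h α A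
  rw [low_of_gt, low_of_lt] at this <;> try (simp only []; omega)
  rw [C.fc_eq (by omega), C.fc_eq (by omega), C.ep_eq (by omega), C.ep_eq (by omega)]
  exact this

theorem fc_ep_gt (hkl : l ≤ k) (hk : k ≤ n) (A : C.cell (n + 1)) :
    C.fc (k + 1) α (C.ep l A) = C.ep l (C.fc k α A) := by
  have h : (⟨k + 1, by omega⟩ : Fin (n + 2)) ≠ ⟨l, by omega⟩ := by simp; omega
  have := C.face_eps _ _ h α A
  rw [low_of_lt, low_of_gt] at this <;> try (simp only []; omega)
  rw [C.fc_eq (by omega), C.fc_eq (by omega), C.ep_eq (by omega), C.ep_eq (by omega)]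
  exact this

theorem fc_cn (hk : k ≤ n) (A : C.cell (n + 1)) : C.fc k α (C.cn k α A) = A := by
  rw [C.fc_eq (by omega), C.cn_eq (by omega)]
  exact C.face_conn_self ⟨k, by omega⟩ α A

theorem fc_cn_succ (hk : k ≤ n) (A : C.cell (n + 1)) : C.fc (k + 1) α (C.cn k α A) = A := by
  rw [C.fc_eq (by omega), C.cn_eq (by omega)]
  exact C.face_conn_self_succ ⟨k, by omega⟩ α A

theorem fc_cn_opp (hk : k ≤ n) (h : β = !α) (A : C.cell (n + 1)) :
    C.fc k α (C.cn k β A) = C.ep k (C.fc k α A) := by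
  subst h
  rw [C.fc_eq (by omega), C.cn_eq (by omega), C.ep_eq (by omega), C.fc_eq (by omega)]
  exact C.face_conn_opp ⟨k, by omega⟩ α A

theorem fc_cn_opp_succ (hk : k ≤ n) (h : β = !α) (A : C.cell (n + 1)) :
    C.fc (k + 1) α (C.cn k β A) = C.ep k (C.fc k α A) := by
  subst h
  rw [C.fc_eq (by omega), C.cn_eq (by omega), C.ep_eq (by omega), C.fc_eq (by omega)]
  exact C.face_conn_opp_succ ⟨k, by omega⟩ α A

theorem fc_cn_lt (hkl : k ≤ l) (hl : l ≤ n) (A : C.cell (n + 2)) :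
    C.fc k α (C.cn (l + 1) β A) = C.cn l β (C.fc k α A) := by
  rw [C.fc_eq (by omega), C.cn_eq (by omega), C.cn_eq (by omega), C.fc_eq (by omega)]
  exact C.face_conn_lt ⟨k, by omega⟩ ⟨l, by omega⟩ hkl α β A

theorem fc_cn_gt (hkl : l < k) (hk : k ≤ n + 1) (A : C.cell (n + 2)) :
    C.fc (k + 1) α (C.cn l β A) = C.cn l β (C.fc k α A) := by
  rw [C.fc_eq (by omega), C.cn_eq (by omega), C.cn_eq (by omega), C.fc_eq (by omega)]
  exact C.face_conn_gt ⟨k, by omega⟩ ⟨l, by omega⟩ hkl α β A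

theorem ep_ep (hkl : k ≤ l) (hl : l ≤ n) (A : C.cell n) :
    C.ep k (C.ep l A) = C.ep (l + 1) (C.ep k A) := by
  rw [C.ep_eq (by omega), C.ep_eq (by omega), C.ep_eq (by omega), C.ep_eq (by omega)]
  exact C.eps_eps ⟨k, by omega⟩ ⟨l, by omega⟩ hkl A

theorem cn_cn (hkl : k < l) (hl : l ≤ n) (A : C.cell (n + 1)) :
    C.cn k α (C.cn l β A) = C.cn (l + 1) β (C.cn k α A) := by
  rw [C.cn_eq (by omega), C.cn_eq (by omega), C.cn_eq (by omega), C.cn_eq (by omega)]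
  exact C.conn_conn ⟨k, by omega⟩ ⟨l, by omega⟩ hkl α β A

theorem cn_cn_self (hk : k ≤ n) (A : C.cell (n + 1)) :
    C.cn (k + 1) α (C.cn k α A) = C.cn k α (C.cn k α A) := by
  rw [C.cn_eq (by omega), C.cn_eq (by omega), C.cn_eq (by omega)]
  exact C.conn_conn_self ⟨k, by omega⟩ α A

theorem succAbove_le (hkl : k ≤ l) (hl : l < n) (hk : k < n + 1) :
    Fin.succAbove (⟨k, hk⟩ : Fin (n + 1)) ⟨l, hl⟩ = ⟨l + 1, by omega⟩ := by
  rw [Fin.succAbove_of_le_castSucc _ _ (by simpa [Fin.le_def] using hkl)]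
  rfl

theorem succAbove_gt (hkl : l < k) (hl : l < n) (hk : k < n + 1) :
    Fin.succAbove (⟨k, hk⟩ : Fin (n + 1)) ⟨l, hl⟩ = ⟨l, by omega⟩ := by
  rw [Fin.succAbove_of_castSucc_lt _ _ (by simpa [Fin.lt_def] using hkl)]
  rfl

theorem cn_ep_lt (hkl : k ≤ l) (hl : l ≤ n) (A : C.cell (n + 1)) :
    C.cn k α (C.ep (l + 1) A) = C.ep (l + 2) (C.cn k α A) := by
  have h : (⟨k, by omega⟩ : Fin (n + 2)) ≠ ⟨l + 1, by omega⟩ := by simp; omega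
  have := C.conn_eps _ _ h α A
  rw [low_of_lt _ (Nat.lt_succ_of_le hkl)] at this
  rw [C.cn_eq (by omega), C.cn_eq (by omega), C.ep_eq (by omega), C.ep_eq (by omega), this]
  exact congrArg (fun i => C.eps i _) (succAbove_le (k := k) (l := l + 1) (by omega) (by omega) (by omega))

theorem cn_ep_gt (hkl : l ≤ k) (hk : k ≤ n) (A : C.cell (n + 1)) :
    C.cn (k + 1) α (C.ep l A) = C.ep l (C.cn k α A) := by
  have h : (⟨k + 1, by omega⟩ : Fin (n + 2)) ≠ ⟨l, by omega⟩ := by simp; omega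
  have := C.conn_eps _ _ h α A
  rw [low_of_gt _ (Nat.lt_succ_of_le hkl)] at this
  rw [C.cn_eq (by omega), C.cn_eq (by omega), C.ep_eq (by omega), C.ep_eq (by omega), this]
  exact congrArg (fun i => C.eps i _) (succAbove_gt (k := k + 1) (l := l) (by omega) (by omega) (by omega))

theorem cn_ep_self (hk : k ≤ n) (A : C.cell n) :
    C.cn k α (C.ep k A) = C.ep k (C.ep k A) := by
  rw [C.cn_eq (by omega), C.ep_eq (by omega), C.ep_eq (by omega)]
  exact C.conn_eps_self ⟨k, by omega⟩ α A

theorem fc_cp_neg (hk : k ≤ n) (A B : C.cell (n + 1)) (h : C.fc k true A = C.fc k false B) :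
    C.fc k false (C.cp k A B) = C.fc k false A := by
  rw [C.fc_eq (by omega), C.fc_eq (by omega)] at h
  rw [C.fc_eq (by omega), C.cp_eq (by omega) _ _ h, C.face_comp_neg, C.fc_eq]

theorem fc_cp_pos (hk : k ≤ n) (A B : C.cell (n + 1)) (h : C.fc k true A = C.fc k false B) :
    C.fc k true (C.cp k A B) = C.fc k true B := by
  rw [C.fc_eq (by omega), C.fc_eq (by omega)] at h
  rw [C.fc_eq (by omega), C.cp_eq (by omega) _ _ h, C.face_comp_pos, C.fc_eq]

theorem fc_cp_lt (hkl : k ≤ l) (hl : l ≤ n) (A B : C.cell (n + 2))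
    (h : C.fc (l + 1) true A = C.fc (l + 1) false B) :
    C.fc k α (C.cp (l + 1) A B) = C.cp l (C.fc k α A) (C.fc k α B) := by
  rw [C.fc_eq (by omega), C.fc_eq (by omega)] at h
  have hn : (⟨k, by omega⟩ : Fin (n + 2)) ≠ ⟨l + 1, by omega⟩ := by simp; omega
  have h' := C.composable_face _ _ hn α A B h
  have e : low (⟨l + 1, by omega⟩ : Fin (n + 2)) ⟨k, by omega⟩ hn.symm = ⟨l, by omega⟩ := by
    rw [low_of_gt _ (by simp only []; omega)]; rfl
  rw [C.fc_eq (by omega), C.cp_eq (by omega) _ _ h, C.face_comp _ _ hn α A B h h',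
    C.fc_eq (by omega), C.fc_eq (by omega), cp_eq']
  congr 1
  exact congrArg Fin.val e

theorem fc_cp_gt (hkl : l ≤ k) (hk : k ≤ n) (A B : C.cell (n + 2))
    (h : C.fc l true A = C.fc l false B) :
    C.fc (k + 1) α (C.cp l A B) = C.cp l (C.fc (k + 1) α A) (C.fc (k + 1) α B) := by
  rw [C.fc_eq (by omega), C.fc_eq (by omega)] at h
  have hn : (⟨k + 1, by omega⟩ : Fin (n + 2)) ≠ ⟨l, by omega⟩ := by simp; omega
  have h' := C.composable_face _ _ hn α A B h
  have e : low (⟨l, by omega⟩ : Fin (n + 2)) ⟨k + 1, by omega⟩ hn.symm = ⟨l, by omega⟩ := by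
    rw [low_of_lt _ (by simp only []; omega)]
  rw [C.fc_eq (by omega), C.cp_eq (by omega) _ _ h, C.face_comp _ _ hn α A B h h',
    C.fc_eq (by omega), C.fc_eq (by omega), cp_eq']
  congr 1
  exact congrArg Fin.val e

theorem cp_ep (hk : k ≤ n) (A : C.cell (n + 1)) {X : C.cell n} (h : C.fc k true A = X) :
    C.cp k A (C.ep k X) = A := by
  subst h
  rw [C.fc_eq (by omega), C.ep_eq (by omega), C.cp_eq (by omega), C.comp_eps]
  rw [C.face_eps_self]

theorem ep_cp (hk : k ≤ n) (A : C.cell (n + 1)) {X : C.cell n} (h : C.fc k false A = X) :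
    C.cp k (C.ep k X) A = A := by
  subst h
  rw [C.fc_eq (by omega), C.ep_eq (by omega), C.cp_eq (by omega), C.eps_comp_self]
  rw [C.face_eps_self]

theorem cp_assoc (hk : k ≤ n) (A B D : C.cell (n + 1)) (h : C.fc k true A = C.fc k false B)
    (h' : C.fc k true B = C.fc k false D) :
    C.cp k (C.cp k A B) D = C.cp k A (C.cp k B D) := by
  have h₁ := (C.fc_cp_pos hk A B h).trans h'
  have h₂ := h.trans (C.fc_cp_neg hk B D h').symm
  rw [C.fc_eq (by omega), C.fc_eq (by omega)] at h h' h₁ h₂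
  rw [C.cp_eq (by omega) _ _ h₁, C.cp_eq (by omega) _ _ h₂]
  simp only [C.cp_eq (by omega) _ _ h, C.cp_eq (by omega) _ _ h'] at h₁ h₂ ⊢
  exact (C.assoc _ _ _ _ _ h₂ _ h₁).symm

/-- Composites in another direction are composable in direction `k` when their factors are. -/
theorem composable_cp (hk : k ≤ n) (hl : l ≤ n) (hkl : k ≠ l) (A B A' B' : C.cell (n + 1))
    (h₁ : C.fc k true A = C.fc k false A') (h₂ : C.fc k true B = C.fc k false B')
    (h : C.fc l true A = C.fc l false B) (h' : C.fc l true A' = C.fc l false B') :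
    C.fc k true (C.cp l A B) = C.fc k false (C.cp l A' B') := by
  obtain _ | n := n
  · omega
  obtain hlt | hlt := Nat.lt_or_gt_of_ne hkl
  · obtain ⟨l, rfl⟩ : ∃ m, l = m + 1 := ⟨l - 1, by omega⟩
    rw [C.fc_cp_lt (by omega) (by omega) _ _ h, C.fc_cp_lt (by omega) (by omega) _ _ h', h₁, h₂]
  · obtain ⟨k, rfl⟩ : ∃ m, k = m + 1 := ⟨k - 1, by omega⟩
    rw [C.fc_cp_gt (by omega) (by omega) _ _ h, C.fc_cp_gt (by omega) (by omega) _ _ h', h₁, h₂]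

theorem cp_exchange (hk : k ≤ n) (hl : l ≤ n) (hkl : k ≠ l) (A B A' B' : C.cell (n + 1))
    (h : C.fc l true A = C.fc l false B) (h' : C.fc l true A' = C.fc l false B')
    (h₁ : C.fc k true A = C.fc k false A') (h₂ : C.fc k true B = C.fc k false B') :
    C.cp k (C.cp l A B) (C.cp l A' B') = C.cp l (C.cp k A A') (C.cp k B B') := by
  have h₃ := C.composable_cp hk hl hkl A B A' B' h₁ h₂ h h'
  have h₄ := C.composable_cp hl hk hkl.symm A A' B B' h h' h₁ h₂
  rw [C.fc_eq (by omega), C.fc_eq (by omega)] at h h' h₁ h₂ h₃ h₄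
  rw [C.cp_eq (by omega) _ _ h₃, C.cp_eq (by omega) _ _ h₄]
  simp only [C.cp_eq (by omega) _ _ h, C.cp_eq (by omega) _ _ h', C.cp_eq (by omega) _ _ h₁,
    C.cp_eq (by omega) _ _ h₂] at h₃ h₄ ⊢
  exact C.exchange _ _ (by simpa using hkl.symm) A B A' B' _ _ _ _ h₃ h₄

theorem ep_cp_le (hkl : k ≤ l) (hl : l ≤ n) (A B : C.cell (n + 1))
    (h : C.fc l true A = C.fc l false B) :
    C.ep k (C.cp l A B) = C.cp (l + 1) (C.ep k A) (C.ep k B) := by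
  have h' : C.fc (l + 1) true (C.ep k A) = C.fc (l + 1) false (C.ep k B) := by
    rw [C.fc_ep_gt hkl hl, C.fc_ep_gt hkl hl, h]
  have e := succAbove_le hkl (n := n + 1) (by omega) (by omega)
  rw [C.fc_eq (by omega), C.fc_eq (by omega)] at h h'
  rw [C.cp_eq (by omega) _ _ h, C.cp_eq (by omega) _ _ h', C.ep_eq (by omega)]
  simp only [C.ep_eq (show k < n + 2 by omega)] at h' ⊢
  exact (C.eps_comp ⟨k, by omega⟩ ⟨l, by omega⟩ A B h (by rw [e]; exact h')).trans
    (comp_congr e rfl rfl _ _)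

theorem ep_cp_gt (hkl : l < k) (hk : k ≤ n + 1) (A B : C.cell (n + 1))
    (h : C.fc l true A = C.fc l false B) :
    C.ep k (C.cp l A B) = C.cp l (C.ep k A) (C.ep k B) := by
  obtain ⟨k, rfl⟩ : ∃ m, k = m + 1 := ⟨k - 1, by omega⟩
  have h' : C.fc l true (C.ep (k + 1) A) = C.fc l false (C.ep (k + 1) B) := by
    rw [C.fc_ep_lt (by omega) (by omega), C.fc_ep_lt (by omega) (by omega), h]
  have e := succAbove_gt hkl (n := n + 1) (by omega) (by omega)
  rw [C.fc_eq (by omega), C.fc_eq (by omega)] at h h'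
  rw [C.cp_eq (by omega) _ _ h, C.cp_eq (by omega) _ _ h', C.ep_eq (by omega)]
  simp only [C.ep_eq (show k + 1 < n + 2 by omega)] at h' ⊢
  exact (C.eps_comp ⟨k + 1, by omega⟩ ⟨l, by omega⟩ A B h (by rw [e]; exact h')).trans
    (comp_congr e rfl rfl _ _)

theorem cn_cp_lt (hkl : k < l) (hl : l ≤ n) (A B : C.cell (n + 1))
    (h : C.fc l true A = C.fc l false B) :
    C.cn k α (C.cp l A B) = C.cp (l + 1) (C.cn k α A) (C.cn k α B) := by
  obtain _ | n := n
  · omega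
  have h' : C.fc (l + 1) true (C.cn k α A) = C.fc (l + 1) false (C.cn k α B) := by
    rw [C.fc_cn_gt hkl hl, C.fc_cn_gt hkl hl, h]
  have e := succAbove_le hkl.le (n := n + 2) (by omega) (by omega)
  rw [C.fc_eq (by omega), C.fc_eq (by omega)] at h h'
  rw [C.cp_eq (by omega) _ _ h, C.cp_eq (by omega) _ _ h', C.cn_eq (by omega)]
  simp only [C.cn_eq (show k < n + 2 by omega)] at h' ⊢
  exact (C.conn_comp ⟨k, by omega⟩ ⟨l, by omega⟩ (by simpa using hkl.ne) α A B h
    (by rw [Fin.castSucc_mk, e]; exact h')).trans (comp_congr e rfl rfl _ _)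

theorem cn_cp_gt (hkl : l < k) (hk : k ≤ n) (A B : C.cell (n + 1))
    (h : C.fc l true A = C.fc l false B) :
    C.cn k α (C.cp l A B) = C.cp l (C.cn k α A) (C.cn k α B) := by
  obtain _ | n := n
  · omega
  obtain ⟨k, rfl⟩ : ∃ m, k = m + 1 := ⟨k - 1, by omega⟩
  have h' : C.fc l true (C.cn (k + 1) α A) = C.fc l false (C.cn (k + 1) α B) := by
    rw [C.fc_cn_lt (by omega) (by omega), C.fc_cn_lt (by omega) (by omega), h]
  have e := succAbove_gt hkl (n := n + 2) (by omega) (by omega)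
  rw [C.fc_eq (by omega), C.fc_eq (by omega)] at h h'
  rw [C.cp_eq (by omega) _ _ h, C.cp_eq (by omega) _ _ h', C.cn_eq (by omega)]
  simp only [C.cn_eq (show k + 1 < n + 2 by omega)] at h' ⊢
  exact (C.conn_comp ⟨k + 1, by omega⟩ ⟨l, by omega⟩ (by simpa using hkl.ne') α A B h
    (by rw [Fin.castSucc_mk, e]; exact h')).trans (comp_congr e rfl rfl _ _)

theorem cn_cp_cn (hk : k ≤ n) (A : C.cell (n + 1)) :
    C.cp k (C.cn k true A) (C.cn k false A) = C.ep (k + 1) A := by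
  have h : C.fc k true (C.cn k true A) = C.fc k false (C.cn k false A) := by
    rw [C.fc_cn hk, C.fc_cn hk]
  rw [C.fc_eq (by omega), C.fc_eq (by omega)] at h
  rw [C.cp_eq (by omega) _ _ h, C.ep_eq (by omega)]
  simp only [C.cn_eq (show k < n + 1 by omega)] at h ⊢
  exact C.conn_comp_conn ⟨k, by omega⟩ A h

theorem cn_cp_cn_succ (hk : k ≤ n) (A : C.cell (n + 1)) :
    C.cp (k + 1) (C.cn k true A) (C.cn k false A) = C.ep k A := by
  have h : C.fc (k + 1) true (C.cn k true A) = C.fc (k + 1) false (C.cn k false A) := by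
    rw [C.fc_cn_succ hk, C.fc_cn_succ hk]
  rw [C.fc_eq (by omega), C.fc_eq (by omega)] at h
  rw [C.cp_eq (by omega) _ _ h, C.ep_eq (by omega)]
  simp only [C.cn_eq (show k < n + 1 by omega)] at h ⊢
  exact C.conn_comp_conn_succ ⟨k, by omega⟩ A h

theorem cn_neg_cp (hk : k ≤ n) (A B : C.cell (n + 1)) (h : C.fc k true A = C.fc k false B) :
    C.cn k false (C.cp k A B) =
      C.cp (k + 1) (C.cp k (C.cn k false A) (C.ep (k + 1) B))
        (C.cp k (C.ep k B) (C.cn k false B)) := by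
  have h₁ : C.fc k true (C.cn k false A) = C.fc k false (C.ep (k + 1) B) := by
    rw [C.fc_cn_opp (α := true) (β := false) hk rfl, C.fc_ep_lt le_rfl hk, h]
  have h₂ : C.fc k true (C.ep k B) = C.fc k false (C.cn k false B) := by
    rw [C.fc_cn hk, C.fc_ep_self (by omega)]
  have h₃ : C.fc (k + 1) true (C.cp k (C.cn k false A) (C.ep (k + 1) B)) =
      C.fc (k + 1) false (C.cp k (C.ep k B) (C.cn k false B)) := by
    rw [C.fc_cp_gt le_rfl hk _ _ h₁, C.fc_cp_gt le_rfl hk _ _ h₂, C.fc_cn_opp_succ (α := true) (β := false) hk rfl,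
      C.fc_ep_self (by omega), C.fc_ep_gt le_rfl hk, C.fc_cn_succ hk, h]
  rw [C.fc_eq (by omega), C.fc_eq (by omega)] at h h₁ h₂ h₃
  rw [C.cp_eq (by omega) _ _ h, C.cp_eq (by omega) _ _ h₃, C.cn_eq (by omega)]
  simp only [C.cp_eq (by omega) _ _ h₁, C.cp_eq (by omega) _ _ h₂] at h₃ ⊢
  simp only [C.cn_eq (show k < n + 1 by omega), C.ep_eq (show k < n + 2 by omega),
    C.ep_eq (show k + 1 < n + 2 by omega)] at h₁ h₂ h₃ ⊢
  exact C.conn_neg_comp_self ⟨k, by omega⟩ A B h h₁ h₂ h₃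

theorem cn_pos_cp (hk : k ≤ n) (A B : C.cell (n + 1)) (h : C.fc k true A = C.fc k false B) :
    C.cn k true (C.cp k A B) =
      C.cp (k + 1) (C.cp k (C.cn k true A) (C.ep k A))
        (C.cp k (C.ep (k + 1) A) (C.cn k true B)) := by
  have h₁ : C.fc k true (C.cn k true A) = C.fc k false (C.ep k A) := by
    rw [C.fc_cn hk, C.fc_ep_self (by omega)]
  have h₂ : C.fc k true (C.ep (k + 1) A) = C.fc k false (C.cn k true B) := by
    rw [C.fc_cn_opp (α := false) (β := true) hk rfl, C.fc_ep_lt le_rfl hk, h]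
  have h₃ : C.fc (k + 1) true (C.cp k (C.cn k true A) (C.ep k A)) =
      C.fc (k + 1) false (C.cp k (C.ep (k + 1) A) (C.cn k true B)) := by
    rw [C.fc_cp_gt le_rfl hk _ _ h₁, C.fc_cp_gt le_rfl hk _ _ h₂, C.fc_cn_opp_succ (α := false) (β := true) hk rfl,
      C.fc_ep_self (by omega), C.fc_ep_gt le_rfl hk, C.fc_cn_succ hk, h]
  rw [C.fc_eq (by omega), C.fc_eq (by omega)] at h h₁ h₂ h₃
  rw [C.cp_eq (by omega) _ _ h, C.cp_eq (by omega) _ _ h₃, C.cn_eq (by omega)]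
  simp only [C.cp_eq (by omega) _ _ h₁, C.cp_eq (by omega) _ _ h₂] at h₃ ⊢
  simp only [C.cn_eq (show k < n + 1 by omega), C.ep_eq (show k < n + 2 by omega),
    C.ep_eq (show k + 1 < n + 2 by omega)] at h₁ h₂ h₃ ⊢
  exact C.conn_pos_comp_self ⟨k, by omega⟩ A B h h₁ h₂ h₃

/-! ### The double category of two adjacent directions -/

/-- The double category formed by the `n`-, `(n+1)`- and `(n+2)`-cells in the directions `j` and
`j + 1`. -/
noncomputable def square (n j : ℕ) (hj : j ≤ n) :
    SquareCat (C.cell n) (C.cell (n + 1)) (C.cell (n + 2)) where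
  src := C.fc j false
  tgt := C.fc j true
  one := C.ep j
  mul := C.cp j
  s1 := C.fc j false
  t1 := C.fc j true
  s2 := C.fc (j + 1) false
  t2 := C.fc (j + 1) true
  e1 := C.ep j
  e2 := C.ep (j + 1)
  gp := C.cn j true
  gm := C.cn j false
  c1 := C.cp j
  c2 := C.cp (j + 1)
  src_one _ := C.fc_ep_self hj _
  tgt_one _ := C.fc_ep_self hj _
  src_mul := C.fc_cp_neg hj
  tgt_mul := C.fc_cp_pos hj
  mul_one a v h := C.cp_ep hj a h
  one_mul a v h := C.ep_cp hj a h
  mul_assoc := C.cp_assoc hj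
  src_s2 A := C.fc_fc le_rfl hj A
  tgt_s1 A := (C.fc_fc le_rfl hj A).symm
  tgt_s2 A := C.fc_fc le_rfl hj A
  tgt_t2 A := C.fc_fc le_rfl hj A
  s1_e1 _ := C.fc_ep_self (by omega) _
  t1_e1 _ := C.fc_ep_self (by omega) _
  s2_e1 _ := C.fc_ep_gt le_rfl hj _
  t2_e1 _ := C.fc_ep_gt le_rfl hj _
  s2_e2 _ := C.fc_ep_self (by omega) _
  t2_e2 _ := C.fc_ep_self (by omega) _
  s1_e2 _ := C.fc_ep_lt le_rfl hj _
  t1_e2 _ := C.fc_ep_lt le_rfl hj _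
  s1_gp _ := C.fc_cn_opp hj rfl _
  s2_gp _ := C.fc_cn_opp_succ hj rfl _
  t1_gp _ := C.fc_cn hj _
  t2_gp _ := C.fc_cn_succ hj _
  s1_gm _ := C.fc_cn hj _
  s2_gm _ := C.fc_cn_succ hj _
  t1_gm _ := C.fc_cn_opp hj rfl _
  t2_gm _ := C.fc_cn_opp_succ hj rfl _
  s1_c1 := C.fc_cp_neg (by omega)
  t1_c1 := C.fc_cp_pos (by omega)
  s2_c1 := C.fc_cp_gt le_rfl hj
  t2_c1 := C.fc_cp_gt le_rfl hj
  s2_c2 := C.fc_cp_neg (by omega)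
  t2_c2 := C.fc_cp_pos (by omega)
  s1_c2 := C.fc_cp_lt le_rfl hj
  t1_c2 := C.fc_cp_lt le_rfl hj
  exch A B A' B' := C.cp_exchange (by omega) (by omega) (by omega) A B A' B'
  assoc1 := C.cp_assoc (by omega)
  assoc2 := C.cp_assoc (by omega)
  c1_e1 A a h := C.cp_ep (by omega) A h
  e1_c1 A a h := C.ep_cp (by omega) A h
  c2_e2 A a h := C.cp_ep (by omega) A h
  e2_c2 A a h := C.ep_cp (by omega) A h
  e1_mul := C.ep_cp_le le_rfl hj
  e2_mul := C.ep_cp_gt (by omega) (by omega)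
  e2_one v := (C.ep_ep le_rfl hj v).symm
  gp_one _ := C.cn_ep_self hj _
  gm_one _ := C.cn_ep_self hj _
  gm_mul := C.cn_neg_cp hj
  gp_mul := C.cn_pos_cp hj
  gp_c1_gm := C.cn_cp_cn hj
  gp_c2_gm := C.cn_cp_cn_succ hj

end CubicalOmegaCat

/-! ### Properties of squares stable under composition and folding -/

namespace SquareCat

variable {V E S : Type u} (D : SquareCat V E S)

theorem psi_induction {Q : S → Prop} (h₂ : ∀ X Y, D.t2 X = D.s2 Y → Q X → Q Y → Q (D.c2 X Y))
    (A : S) (hp : Q (D.gp (D.s2 A))) (hA : Q A) (hm : Q (D.gm (D.t2 A))) : Q (D.psi A) :=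
  h₂ _ _ (by rw [D.t2_c2 _ _ (D.t2_gp _), D.s2_gm]) (h₂ _ _ (D.t2_gp _) hp hA) hm

/-- By `unfold`, a square is a composite of its folding with connections and degeneracies, so a
property stable under composition descends from the folding. -/
theorem unfold_induction {Q : S → Prop} (h₁ : ∀ X Y, D.t1 X = D.s1 Y → Q X → Q Y → Q (D.c1 X Y))
    (h₂ : ∀ X Y, D.t2 X = D.s2 Y → Q X → Q Y → Q (D.c2 X Y)) (A : S)
    (hs : Q (D.e1 (D.s1 A))) (ht : Q (D.e1 (D.t1 A))) (hp : Q (D.gp (D.t2 A)))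
    (hm : Q (D.gm (D.s2 A))) (hA : Q (D.psi A)) : Q A := by
  have k₁ : D.t2 (D.e1 (D.s1 A)) = D.s2 (D.gp (D.t2 A)) := by
    rw [D.t2_e1, D.s2_gp, D.tgt_s1]
  have k₂ : D.t2 (D.gm (D.s2 A)) = D.s2 (D.e1 (D.t1 A)) := by
    rw [D.s2_e1, D.t2_gm, D.tgt_s2]
  have k₃ : D.t1 (D.c2 (D.e1 (D.s1 A)) (D.gp (D.t2 A))) = D.s1 (D.psi A) := by
    rw [D.t1_c2 _ _ k₁, D.s1_psi, D.t1_e1, D.t1_gp]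
  rw [← D.unfold A]
  refine h₁ _ _ ?_ (h₁ _ _ k₃ (h₂ _ _ k₁ hs hp) hA) (h₂ _ _ k₂ hm ht)
  rw [D.t1_c1 _ _ k₃, D.t1_psi, D.s1_c2 _ _ k₂, D.s1_gm, D.s1_e1]

theorem psi_c1_induction {Q : S → Prop}
    (h₁ : ∀ X Y, D.t1 X = D.s1 Y → Q X → Q Y → Q (D.c1 X Y))
    (h₂ : ∀ X Y, D.t2 X = D.s2 Y → Q X → Q Y → Q (D.c2 X Y)) (he : ∀ a, Q (D.e1 a))
    {A B : S} (h : D.t1 A = D.s1 B) (hA : Q (D.psi A)) (hB : Q (D.psi B)) :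
    Q (D.psi (D.c1 A B)) := by
  have k₁ : D.t2 (D.psi A) = D.s2 (D.e1 (D.t2 B)) := by
    rw [D.t2_psi, D.s2_e1, h, D.tgt_s1]
  have k₂ : D.t2 (D.e1 (D.s2 A)) = D.s2 (D.psi B) := by
    rw [D.s2_psi, D.t2_e1, ← h, D.tgt_s2]
  rw [D.psi_c1 A B h]
  refine h₁ _ _ ?_ (h₂ _ _ k₁ hA (he _)) (h₂ _ _ k₂ (he _) hB)
  rw [D.t1_c2 _ _ k₁, D.s1_c2 _ _ k₂, D.t1_psi, D.s1_psi, D.t1_e1, D.s1_e1, h,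
    D.mul_assoc _ _ _ (by rw [D.tgt_s2, h]) (D.tgt_s1 B)]

theorem psi_c2_induction {Q : S → Prop}
    (h₁ : ∀ X Y, D.t1 X = D.s1 Y → Q X → Q Y → Q (D.c1 X Y))
    (h₂ : ∀ X Y, D.t2 X = D.s2 Y → Q X → Q Y → Q (D.c2 X Y)) (he : ∀ a, Q (D.e1 a))
    {A B : S} (h : D.t2 A = D.s2 B) (hA : Q (D.psi A)) (hB : Q (D.psi B)) :
    Q (D.psi (D.c2 A B)) := by
  have k₁ : D.t2 (D.e1 (D.s1 A)) = D.s2 (D.psi B) := by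
    rw [D.s2_psi, D.t2_e1, D.tgt_s1, h, D.src_s2]
  have k₂ : D.t2 (D.psi A) = D.s2 (D.e1 (D.t1 B)) := by
    rw [D.t2_psi, D.s2_e1, ← D.tgt_t2, h, D.tgt_s2]
  rw [D.psi_c2 A B h]
  refine h₁ _ _ ?_ (h₂ _ _ k₁ (he _) hB) (h₂ _ _ k₂ hA (he _))
  rw [D.t1_c2 _ _ k₁, D.s1_c2 _ _ k₂, D.t1_psi, D.s1_psi, D.t1_e1, D.s1_e1, h,
    D.mul_assoc _ _ _ (by rw [D.tgt_s1, h]) (D.tgt_s2 B)]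

end SquareCat

/-! ### Invertibility in one direction -/

namespace CubicalOmegaCat

variable (C : CubicalOmegaCat.{u}) {n : ℕ}

/-- `B` is inverse to `A` in direction `k`. -/
structure IsR (k : ℕ) (A B : C.cell (n + 1)) : Prop where
  ts : C.fc k true A = C.fc k false B
  ts' : C.fc k true B = C.fc k false A
  eq : C.cp k A B = C.ep k (C.fc k false A)
  eq' : C.cp k B A = C.ep k (C.fc k true A)

/-- The cell `A` is invertible in direction `k`. -/
def RInv (k : ℕ) (A : C.cell (n + 1)) : Prop := ∃ B, C.IsR k A B

variable {C} {k l : ℕ} {α β : Bool}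

theorem IsR.unique (hk : k ≤ n) {A B B' : C.cell (n + 1)} (h : C.IsR k A B) (h' : C.IsR k A B') :
    B = B' := by
  rw [← C.cp_ep hk B h.ts', ← h'.eq, ← C.cp_assoc hk _ _ _ h.ts' h'.ts, h.eq',
    C.ep_cp hk _ h'.ts.symm]

theorem IsR.face_lt (hkl : k ≤ l) (hl : l ≤ n) {A B : C.cell (n + 2)} (h : C.IsR (l + 1) A B) :
    C.IsR l (C.fc k α A) (C.fc k α B) where
  ts := by rw [← C.fc_fc hkl hl, ← C.fc_fc hkl hl, h.ts]
  ts' := by rw [← C.fc_fc hkl hl, ← C.fc_fc hkl hl, h.ts']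
  eq := by rw [← C.fc_cp_lt hkl hl _ _ h.ts, h.eq, C.fc_ep_lt hkl hl, C.fc_fc hkl hl]
  eq' := by rw [← C.fc_cp_lt hkl hl _ _ h.ts', h.eq', C.fc_ep_lt hkl hl, C.fc_fc hkl hl]

theorem IsR.face_gt (hkl : l ≤ k) (hk : k ≤ n) {A B : C.cell (n + 2)} (h : C.IsR l A B) :
    C.IsR l (C.fc (k + 1) α A) (C.fc (k + 1) α B) where
  ts := by rw [C.fc_fc hkl hk, C.fc_fc hkl hk, h.ts]
  ts' := by rw [C.fc_fc hkl hk, C.fc_fc hkl hk, h.ts']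
  eq := by rw [← C.fc_cp_gt hkl hk _ _ h.ts, h.eq, C.fc_ep_gt hkl hk, C.fc_fc hkl hk]
  eq' := by rw [← C.fc_cp_gt hkl hk _ _ h.ts', h.eq', C.fc_ep_gt hkl hk, C.fc_fc hkl hk]

theorem isR_ep (hk : k ≤ n) (X : C.cell n) : C.IsR k (C.ep k X) (C.ep k X) where
  ts := by rw [C.fc_ep_self hk, C.fc_ep_self hk]
  ts' := by rw [C.fc_ep_self hk, C.fc_ep_self hk]
  eq := by rw [C.fc_ep_self hk, C.cp_ep hk _ (C.fc_ep_self hk _)]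
  eq' := by rw [C.fc_ep_self hk, C.cp_ep hk _ (C.fc_ep_self hk _)]

theorem IsR.ep_gt (hkl : l ≤ k) (hk : k ≤ n) {A B : C.cell (n + 1)} (h : C.IsR l A B) :
    C.IsR l (C.ep (k + 1) A) (C.ep (k + 1) B) where
  ts := by rw [C.fc_ep_lt hkl hk, C.fc_ep_lt hkl hk, h.ts]
  ts' := by rw [C.fc_ep_lt hkl hk, C.fc_ep_lt hkl hk, h.ts']
  eq := by
    rw [← C.ep_cp_gt (by omega) (by omega) _ _ h.ts, h.eq, C.fc_ep_lt hkl hk, C.ep_ep hkl hk]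
  eq' := by
    rw [← C.ep_cp_gt (by omega) (by omega) _ _ h.ts', h.eq', C.fc_ep_lt hkl hk, C.ep_ep hkl hk]

theorem IsR.cn_gt (hkl : l < k) (hk : k ≤ n) {A B : C.cell (n + 1)} (h : C.IsR l A B) :
    C.IsR l (C.cn k α A) (C.cn k α B) := by
  obtain _ | n := n
  · omega
  obtain ⟨k, rfl⟩ : ∃ m, k = m + 1 := ⟨k - 1, by omega⟩
  have h₁ : l ≤ k := by omega
  have h₂ : k ≤ n := by omega
  exact
    { ts := by rw [C.fc_cn_lt h₁ h₂, C.fc_cn_lt h₁ h₂, h.ts]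
      ts' := by rw [C.fc_cn_lt h₁ h₂, C.fc_cn_lt h₁ h₂, h.ts']
      eq := by rw [← C.cn_cp_gt hkl hk _ _ h.ts, h.eq, C.fc_cn_lt h₁ h₂, C.cn_ep_gt h₁ h₂]
      eq' := by rw [← C.cn_cp_gt hkl hk _ _ h.ts', h.eq', C.fc_cn_lt h₁ h₂, C.cn_ep_gt h₁ h₂] }

theorem RInv.face_lt (hkl : k ≤ l) (hl : l ≤ n) {A : C.cell (n + 2)} (h : C.RInv (l + 1) A) :
    C.RInv l (C.fc k α A) :=
  ⟨_, h.choose_spec.face_lt hkl hl⟩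

theorem RInv.face_gt (hkl : l ≤ k) (hk : k ≤ n) {A : C.cell (n + 2)} (h : C.RInv l A) :
    C.RInv l (C.fc (k + 1) α A) :=
  ⟨_, h.choose_spec.face_gt hkl hk⟩

theorem rInv_ep (hk : k ≤ n) (X : C.cell n) : C.RInv k (C.ep k X) := ⟨_, isR_ep hk X⟩

theorem RInv.ep_gt (hkl : l ≤ k) (hk : k ≤ n) {A : C.cell (n + 1)} (h : C.RInv l A) :
    C.RInv l (C.ep (k + 1) A) :=
  ⟨_, h.choose_spec.ep_gt hkl hk⟩

theorem RInv.cn_gt (hkl : l < k) (hk : k ≤ n) {A : C.cell (n + 1)} (h : C.RInv l A) :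
    C.RInv l (C.cn k α A) :=
  ⟨_, h.choose_spec.cn_gt hkl hk⟩

theorem RInv.isInvE (hk : k ≤ n) {A : C.cell (n + 1)} (h : C.RInv k A) :
    ∃ B, (C.square n k hk).IsInvE A B :=
  h.imp fun _ h => ⟨h.ts, h.ts', h.eq, h.eq'⟩

theorem rInv_of_isInv1 (hk : k ≤ n) {A B : C.cell (n + 2)} (h : (C.square n k hk).IsInv1 A B) :
    C.RInv k A :=
  ⟨B, h.ts, h.ts', h.eq, h.eq'⟩

theorem rInv_of_isInv2 (hk : k ≤ n) {A B : C.cell (n + 2)}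
    (h : (C.square n k hk).transpose.IsInv1 A B) : C.RInv (k + 1) A :=
  ⟨B, h.ts, h.ts', h.eq, h.eq'⟩

theorem RInv.isInv1 (hk : k ≤ n) {A : C.cell (n + 2)} (h : C.RInv k A) :
    ∃ B, (C.square n k hk).IsInv1 A B :=
  h.imp fun _ h => ⟨h.ts, h.ts', h.eq, h.eq'⟩

theorem RInv.isInv2 (hk : k ≤ n) {A : C.cell (n + 2)} (h : C.RInv (k + 1) A) :
    ∃ B, (C.square n k hk).transpose.IsInv1 A B :=
  h.imp fun _ h => ⟨h.ts, h.ts', h.eq, h.eq'⟩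

theorem RInv.cn_self (hk : k ≤ n) {A : C.cell (n + 1)} (h : C.RInv k A) :
    C.RInv k (C.cn k α A) := by
  obtain ⟨B, h⟩ := h.isInvE hk
  cases α
  · exact rInv_of_isInv1 hk h.gm
  · exact rInv_of_isInv1 hk h.gp

theorem RInv.cn_self_succ (hk : k ≤ n) {A : C.cell (n + 1)} (h : C.RInv k A) :
    C.RInv (k + 1) (C.cn k α A) := by
  obtain ⟨B, h⟩ := h.isInvE hk
  have h' : (C.square n k hk).transpose.IsInvE A B := ⟨h.ts, h.ts', h.eq, h.eq'⟩
  cases α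
  · exact rInv_of_isInv2 hk h'.gm
  · exact rInv_of_isInv2 hk h'.gp

/-- Inverses compose in reverse order in the direction k itself, and in the same order in any other
direction, by exchange. -/
theorem RInv.cp (hk : k ≤ n) (hl : l ≤ n) {A A' : C.cell (n + 1)}
    (hAA : C.fc l true A = C.fc l false A') (h : C.RInv k A) (h' : C.RInv k A') :
    C.RInv k (C.cp l A A') := by
  obtain ⟨B, h⟩ := h
  obtain ⟨B', h'⟩ := h'
  obtain rfl | hkl := eq_or_ne k l
  · have hBB : C.fc k true B' = C.fc k false B := by rw [h'.ts', ← hAA, h.ts]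
    refine ⟨C.cp k B' B, ?_, ?_, ?_, ?_⟩
    · rw [C.fc_cp_pos hk _ _ hAA, C.fc_cp_neg hk _ _ hBB, h'.ts]
    · rw [C.fc_cp_pos hk _ _ hBB, C.fc_cp_neg hk _ _ hAA, h.ts']
    · rw [C.cp_assoc hk _ _ _ hAA (by rw [C.fc_cp_neg hk _ _ hBB, h'.ts]),
        ← C.cp_assoc hk _ _ _ h'.ts hBB, h'.eq, C.ep_cp hk _ (by rw [← hAA, h.ts]), h.eq,
        C.fc_cp_neg hk _ _ hAA]
    · rw [C.cp_assoc hk _ _ _ hBB (by rw [C.fc_cp_neg hk _ _ hAA, h.ts']),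
        ← C.cp_assoc hk _ _ _ h.ts' hAA, h.eq', C.ep_cp hk _ hAA.symm, h'.eq',
        C.fc_cp_pos hk _ _ hAA]
  · obtain _ | n := n
    · omega
    obtain hlt | hlt := Nat.lt_or_gt_of_ne hkl
    · obtain ⟨l, rfl⟩ : ∃ m, l = m + 1 := ⟨l - 1, by omega⟩
      have hkl : k ≤ l := by omega
      have hln : l ≤ n := by omega
      -- Faces of inverses are inverses of faces; uniqueness makes the two inverses composable.
      have hBB : C.fc (l + 1) true B = C.fc (l + 1) false B' := by
        refine (h.face_gt hkl hln).unique (by omega) ?_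
        rw [hAA]
        exact h'.face_gt hkl hln
      have e : ∀ α, C.ep (n := n + 1) k (C.fc k α (C.cp (l + 1) A A')) =
          C.cp (l + 1) (C.ep k (C.fc k α A)) (C.ep k (C.fc k α A')) := fun α => by
        rw [C.fc_cp_lt hkl hln _ _ hAA, C.ep_cp_le hkl hln]
        rw [← C.fc_fc hkl hln, ← C.fc_fc hkl hln, hAA]
      refine ⟨C.cp (l + 1) B B', ?_, ?_, ?_, ?_⟩
      · exact C.composable_cp hk hl (by omega) _ _ _ _ h.ts h'.ts hAA hBB
      · exact C.composable_cp hk hl (by omega) _ _ _ _ h.ts' h'.ts' hBB hAA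
      · rw [C.cp_exchange hk hl (by omega) _ _ _ _ hAA hBB h.ts h'.ts, h.eq, h'.eq, e]
      · rw [C.cp_exchange hk hl (by omega) _ _ _ _ hBB hAA h.ts' h'.ts', h.eq', h'.eq', e]
    · obtain ⟨k, rfl⟩ : ∃ m, k = m + 1 := ⟨k - 1, by omega⟩
      have hkl : l ≤ k := by omega
      have hkn : k ≤ n := by omega
      have hBB : C.fc l true B = C.fc l false B' := by
        refine (h.face_lt hkl hkn).unique (by omega) ?_
        rw [hAA]
        exact h'.face_lt hkl hkn
      have e : ∀ α, C.ep (n := n + 1) (k + 1) (C.fc (k + 1) α (C.cp l A A')) =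
          C.cp l (C.ep (k + 1) (C.fc (k + 1) α A)) (C.ep (k + 1) (C.fc (k + 1) α A')) := fun α => by
        rw [C.fc_cp_gt hkl hkn _ _ hAA, C.ep_cp_gt hlt (by omega)]
        rw [C.fc_fc hkl hkn, C.fc_fc hkl hkn, hAA]
      refine ⟨C.cp l B B', ?_, ?_, ?_, ?_⟩
      · exact C.composable_cp hk hl (by omega) _ _ _ _ h.ts h'.ts hAA hBB
      · exact C.composable_cp hk hl (by omega) _ _ _ _ h.ts' h'.ts' hBB hAA
      · rw [C.cp_exchange hk hl (by omega) _ _ _ _ hAA hBB h.ts h'.ts, h.eq, h'.eq, e]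
      · rw [C.cp_exchange hk hl (by omega) _ _ _ _ hBB hAA h.ts' h'.ts', h.eq', h'.eq', e]

/-! ### Foldings of cells -/

variable (C)

/-- The folding `ψ_j`, with a natural number for the direction. -/
noncomputable def ps (j : ℕ) (A : C.cell (n + 2)) : C.cell (n + 2) :=
  C.cp (j + 1) (C.cp (j + 1) (C.cn j true (C.fc (j + 1) false A)) A)
    (C.cn j false (C.fc (j + 1) true A))

/-- The transposed folding in the directions `j` and `j + 1`. -/
noncomputable def psT (j : ℕ) (A : C.cell (n + 2)) : C.cell (n + 2) :=
  C.cp j (C.cp j (C.cn j true (C.fc j false A)) A) (C.cn j false (C.fc j true A))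

variable {j : ℕ}

theorem ps_induction (hj : j ≤ n) {Q : C.cell (n + 2) → Prop}
    (h : ∀ X Y, C.fc (j + 1) true X = C.fc (j + 1) false Y → Q X → Q Y → Q (C.cp (j + 1) X Y))
    {A : C.cell (n + 2)} (hc : ∀ α β, Q (C.cn j α (C.fc (j + 1) β A))) (hA : Q A) :
    Q (C.ps j A) :=
  (C.square n j hj).psi_induction h A (hc _ _) hA (hc _ _)

theorem psT_induction (hj : j ≤ n) {Q : C.cell (n + 2) → Prop}
    (h : ∀ X Y, C.fc j true X = C.fc j false Y → Q X → Q Y → Q (C.cp j X Y))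
    {A : C.cell (n + 2)} (hc : ∀ α β, Q (C.cn j α (C.fc j β A))) (hA : Q A) :
    Q (C.psT j A) :=
  (C.square n j hj).transpose.psi_induction h A (hc _ _) hA (hc _ _)

theorem of_ps (hj : j ≤ n) {Q : C.cell (n + 2) → Prop}
    (h : ∀ l ≤ n + 1, ∀ X Y, C.fc l true X = C.fc l false Y → Q X → Q Y → Q (C.cp l X Y))
    {A : C.cell (n + 2)} (hc : ∀ α β, Q (C.cn j α (C.fc (j + 1) β A)))
    (he : ∀ α, Q (C.ep j (C.fc j α A))) (hA : Q (C.ps j A)) : Q A :=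
  (C.square n j hj).unfold_induction (h _ (by omega)) (h _ (by omega)) A (he _) (he _) (hc _ _)
    (hc _ _) hA

theorem of_psT (hj : j ≤ n) {Q : C.cell (n + 2) → Prop}
    (h : ∀ l ≤ n + 1, ∀ X Y, C.fc l true X = C.fc l false Y → Q X → Q Y → Q (C.cp l X Y))
    {A : C.cell (n + 2)} (hc : ∀ α β, Q (C.cn j α (C.fc j β A)))
    (he : ∀ α, Q (C.ep (j + 1) (C.fc (j + 1) α A))) (hA : Q (C.psT j A)) : Q A :=
  (C.square n j hj).transpose.unfold_induction (h _ (by omega)) (h _ (by omega)) A (he _) (he _)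
    (hc _ _) (hc _ _) hA

theorem rInv_psT_of_ps (hj : j ≤ n) {A : C.cell (n + 2)} (h : C.RInv j (C.ps j A)) :
    C.RInv (j + 1) (C.psT j A) := by
  obtain ⟨B, h⟩ := h.isInv1 hj
  exact rInv_of_isInv2 hj (SquareCat.IsInv1.psiT_psi h)

theorem rInv_ps_of_psT (hj : j ≤ n) {A : C.cell (n + 2)} (h : C.RInv (j + 1) (C.psT j A)) :
    C.RInv j (C.ps j A) := by
  obtain ⟨B, h⟩ := h.isInv2 hj
  exact rInv_of_isInv1 hj (SquareCat.IsInv1.psiT_psi (D := (C.square n j hj).transpose) h)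

/-- The cell `psT j A` is composed of A and connections of its faces, all ⋆_{j+1}-invertible; going
from `psT` to `ps` exchanges the two directions. -/
theorem RInv.ps_succ (hj : j ≤ n) {A : C.cell (n + 2)} (h : C.RInv (j + 1) A) :
    C.RInv j (C.ps j A) :=
  C.rInv_ps_of_psT hj <| C.psT_induction hj (fun _ _ e h h' => h.cp (by omega) (by omega) e h')
    (fun _ _ => (h.face_lt le_rfl hj).cn_self_succ hj) h

theorem ps_ep_self (hj : j ≤ n) (X : C.cell (n + 1)) : C.ps j (C.ep j X) = C.ep j X :=
  (C.square n j hj).psi_e1 X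

theorem ps_ep_succ (hj : j ≤ n) (X : C.cell (n + 1)) : C.ps j (C.ep (j + 1) X) = C.ep j X :=
  (C.square n j hj).psi_e2 X

theorem ps_cn_self (hj : j ≤ n) (X : C.cell (n + 1)) : C.ps j (C.cn j α X) = C.ep j X := by
  cases α
  · exact (C.square n j hj).psi_gm X
  · exact (C.square n j hj).psi_gp X

theorem fc_ps_succ (hj : j ≤ n) (A : C.cell (n + 2)) :
    ∃ X, C.fc (j + 1) α (C.ps j A) = C.ep j X := by
  cases α
  · exact ⟨_, (C.square n j hj).s2_psi A⟩
  · exact ⟨_, (C.square n j hj).t2_psi A⟩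

theorem fc_psT_self (hj : j ≤ n) (A : C.cell (n + 2)) :
    ∃ X, C.fc j α (C.psT j A) = C.ep j X := by
  cases α
  · exact ⟨_, (C.square n j hj).s1_psiT A⟩
  · exact ⟨_, (C.square n j hj).t1_psiT A⟩

theorem fc_ps_lt (hk : k ≤ j) (hj : j ≤ n) (A : C.cell (n + 3)) :
    C.fc k α (C.ps (j + 1) A) = C.ps j (C.fc k α A) := by
  have h₁ : C.fc (j + 1 + 1) true (C.cn (j + 1) true (C.fc (j + 1 + 1) false A)) =
      C.fc (j + 1 + 1) false A := C.fc_cn_succ (by omega) _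
  have h₂ : C.fc (j + 1 + 1) false (C.cn (j + 1) false (C.fc (j + 1 + 1) true A)) =
      C.fc (j + 1 + 1) true A := C.fc_cn_succ (by omega) _
  rw [ps, C.fc_cp_lt (by omega) (by omega), C.fc_cp_lt (by omega) (by omega) _ _ h₁,
    C.fc_cn_lt hk hj, C.fc_cn_lt hk hj, C.fc_fc (by omega) (by omega),
    C.fc_fc (by omega) (by omega)]
  · rfl
  · rw [C.fc_cp_pos (by omega) _ _ h₁, h₂]

theorem fc_ps_gt (hk : j < k) (hkn : k ≤ n + 1) (A : C.cell (n + 3)) :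
    C.fc (k + 1) α (C.ps j A) = C.ps j (C.fc (k + 1) α A) := by
  have h₁ : C.fc (j + 1) true (C.cn j true (C.fc (j + 1) false A)) =
      C.fc (j + 1) false A := C.fc_cn_succ (by omega) _
  have h₂ : C.fc (j + 1) false (C.cn j false (C.fc (j + 1) true A)) =
      C.fc (j + 1) true A := C.fc_cn_succ (by omega) _
  rw [ps, C.fc_cp_gt (by omega) (by omega), C.fc_cp_gt (by omega) (by omega) _ _ h₁,
    C.fc_cn_gt hk hkn, C.fc_cn_gt hk hkn, ← C.fc_fc (k := j + 1) (l := k) (by omega) (by omega),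
    ← C.fc_fc (k := j + 1) (l := k) (by omega) (by omega)]
  · rfl
  · rw [C.fc_cp_pos (by omega) _ _ h₁, h₂]

theorem fc_psT_lt (hk : k ≤ j) (hj : j ≤ n) (A : C.cell (n + 3)) :
    C.fc k α (C.psT (j + 1) A) = C.psT j (C.fc k α A) := by
  have h₁ : C.fc (j + 1) true (C.cn (j + 1) true (C.fc (j + 1) false A)) =
      C.fc (j + 1) false A := C.fc_cn (by omega) _
  have h₂ : C.fc (j + 1) false (C.cn (j + 1) false (C.fc (j + 1) true A)) =
      C.fc (j + 1) true A := C.fc_cn (by omega) _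
  rw [psT, C.fc_cp_lt (by omega) (by omega), C.fc_cp_lt (by omega) (by omega) _ _ h₁,
    C.fc_cn_lt hk hj, C.fc_cn_lt hk hj, C.fc_fc (by omega) (by omega),
    C.fc_fc (by omega) (by omega)]
  · rfl
  · rw [C.fc_cp_pos (by omega) _ _ h₁, h₂]

theorem fc_psT_gt (hk : j < k) (hkn : k ≤ n + 1) (A : C.cell (n + 3)) :
    C.fc (k + 1) α (C.psT j A) = C.psT j (C.fc (k + 1) α A) := by
  have h₁ : C.fc j true (C.cn j true (C.fc j false A)) =
      C.fc j false A := C.fc_cn (by omega) _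
  have h₂ : C.fc j false (C.cn j false (C.fc j true A)) =
      C.fc j true A := C.fc_cn (by omega) _
  rw [psT, C.fc_cp_gt (by omega) (by omega), C.fc_cp_gt (by omega) (by omega) _ _ h₁,
    C.fc_cn_gt hk hkn, C.fc_cn_gt hk hkn, ← C.fc_fc (k := j) (l := k) (by omega) (by omega),
    ← C.fc_fc (k := j) (l := k) (by omega) (by omega)]
  · rfl
  · rw [C.fc_cp_pos (by omega) _ _ h₁, h₂]

/-! ### Plain invertibility: degeneracies, composites, connections -/

/-- The partial invertibility of `A` relative to `ψ_0 ⋯ ψ_{j-1}`. -/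
def PInv : ℕ → C.cell (n + 2) → Prop
  | 0, A => C.RInv 0 A
  | j + 1, A => PInv j (C.ps j A)

/-- The folding ψ_j keeps the form ε_k for k < j and sends both ε_j and ε_{j+1} to ε_j, so the index
stays within the range of the remaining foldings. -/
theorem pInv_ep (hj : j ≤ n + 1) (hk : k ≤ j) (X : C.cell (n + 1)) : C.PInv j (C.ep k X) := by
  induction j generalizing k X with
  | zero =>
    obtain rfl : k = 0 := by omega
    exact rInv_ep (by omega) X
  | succ j ih =>
    rw [PInv]
    obtain hk | rfl | rfl : k < j ∨ k = j ∨ k = j + 1 := by omega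
    · obtain ⟨Y, hY⟩ : ∃ Y, C.ps j (C.ep k X) = C.ep k Y := by
        refine C.ps_induction (by omega) (Q := fun Z => ∃ Y, Z = C.ep k Y) ?_ ?_ ⟨_, rfl⟩
        · rintro _ _ h ⟨Y, rfl⟩ ⟨Z, rfl⟩
          rw [C.fc_ep_gt hk.le (by omega), C.fc_ep_gt hk.le (by omega)] at h
          have h' := congrArg (C.fc k true) h
          rw [C.fc_ep_self (by omega), C.fc_ep_self (by omega)] at h'
          exact ⟨_, (C.ep_cp_le hk.le (by omega) _ _ h').symm⟩
        · intro α β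
          obtain _ | n := n
          · omega
          obtain ⟨j, rfl⟩ : ∃ m, j = m + 1 := ⟨j - 1, by omega⟩
          rw [C.fc_ep_gt hk.le (by omega), C.cn_ep_gt (by omega) (by omega)]
          exact ⟨_, rfl⟩
      rw [hY]
      exact ih (by omega) hk.le Y
    · rw [C.ps_ep_self (by omega)]
      exact ih (by omega) le_rfl X
    · rw [C.ps_ep_succ (by omega)]
      exact ih (by omega) le_rfl X

theorem cn_fc_cp (hj : j ≤ n) (hl : l ≤ n + 1) (h₁ : l ≠ j) (h₂ : l ≠ j + 1)
    {A B : C.cell (n + 2)} (h : C.fc l true A = C.fc l false B) :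
    C.cn j α (C.fc (j + 1) β (C.cp l A B)) =
        C.cp l (C.cn j α (C.fc (j + 1) β A)) (C.cn j α (C.fc (j + 1) β B)) ∧
      C.fc l true (C.cn j α (C.fc (j + 1) β A)) = C.fc l false (C.cn j α (C.fc (j + 1) β B)) := by
  obtain _ | n := n
  · omega
  obtain hlj | hlj : l < j ∨ j + 1 < l := by omega
  · have h' : C.fc l true (C.fc (j + 1) β A) = C.fc l false (C.fc (j + 1) β B) := by
      rw [C.fc_fc hlj.le hj, C.fc_fc hlj.le hj, h]
    refine ⟨by rw [C.fc_cp_gt hlj.le hj _ _ h, C.cn_cp_gt hlj hj _ _ h'], ?_⟩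
    obtain ⟨j, rfl⟩ : ∃ m, j = m + 1 := ⟨j - 1, by omega⟩
    rw [C.fc_cn_lt (by omega) (by omega), C.fc_cn_lt (by omega) (by omega), h']
  · obtain ⟨l, rfl⟩ : ∃ m, l = m + 1 := ⟨l - 1, by omega⟩
    have h' : C.fc l true (C.fc (j + 1) β A) = C.fc l false (C.fc (j + 1) β B) := by
      rw [← C.fc_fc (k := j + 1) (l := l) (by omega) (by omega),
        ← C.fc_fc (k := j + 1) (l := l) (by omega) (by omega), h]
    refine ⟨?_, ?_⟩
    · rw [C.fc_cp_lt (by omega) (by omega) _ _ h, C.cn_cp_lt (by omega) (by omega) _ _ h']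
    · rw [C.fc_cn_gt (by omega) (by omega), C.fc_cn_gt (by omega) (by omega), h']

theorem ps_cp (hj : j ≤ n) (hl : l ≤ n + 1) (h₁ : l ≠ j) (h₂ : l ≠ j + 1)
    {A B : C.cell (n + 2)} (h : C.fc l true A = C.fc l false B) :
    C.ps j (C.cp l A B) = C.cp l (C.ps j A) (C.ps j B) ∧
      C.fc l true (C.ps j A) = C.fc l false (C.ps j B) := by
  have hp := C.cn_fc_cp hj hl h₁ h₂ (α := true) (β := false) h
  have hm := C.cn_fc_cp hj hl h₁ h₂ (α := false) (β := true) h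
  have a₁ : ∀ A : C.cell (n + 2), C.fc (j + 1) true (C.cn j true (C.fc (j + 1) false A)) =
      C.fc (j + 1) false A := fun A => C.fc_cn_succ hj _
  have a₂ : ∀ A : C.cell (n + 2), C.fc (j + 1) true
      (C.cp (j + 1) (C.cn j true (C.fc (j + 1) false A)) A) =
      C.fc (j + 1) false (C.cn j false (C.fc (j + 1) true A)) := fun A => by
    rw [C.fc_cp_pos (by omega) _ _ (a₁ A), C.fc_cn_succ hj]
  have c := C.composable_cp hl (by omega) h₂ _ _ _ _ hp.2 h (a₁ A) (a₁ B)
  refine ⟨?_, C.composable_cp hl (by omega) h₂ _ _ _ _ c hm.2 (a₂ A) (a₂ B)⟩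
  rw [ps, hp.1, hm.1, C.cp_exchange (by omega) hl h₂.symm _ _ _ _ hp.2 h (a₁ A) (a₁ B),
    C.cp_exchange (by omega) hl h₂.symm _ _ _ _ c hm.2 (a₂ A) (a₂ B)]
  rfl

/-- The folding ψ_j commutes with ⋆_l unless l is j or j+1. In those two cases it yields a composite
of foldings whiskered by cells ε_j, which is why the induction runs over all directions at once. -/
theorem PInv.cp (hj : j ≤ n + 1) (hl : l ≤ n + 1) {A B : C.cell (n + 2)}
    (h : C.fc l true A = C.fc l false B) (hA : C.PInv j A) (hB : C.PInv j B) :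
    C.PInv j (C.cp l A B) := by
  induction j generalizing l A B with
  | zero => exact RInv.cp (by omega) hl h hA hB
  | succ j ih =>
    rw [PInv] at hA hB ⊢
    have hjn : j ≤ n := by omega
    obtain rfl | rfl | hl' : l = j ∨ l = j + 1 ∨ (l ≠ j ∧ l ≠ j + 1) := by omega
    · exact (C.square n l hjn).psi_c1_induction (Q := C.PInv l)
        (fun _ _ => ih (by omega) (by omega)) (fun _ _ => ih (by omega) (by omega))
        (C.pInv_ep (by omega) le_rfl) h hA hB
    · exact (C.square n j hjn).psi_c2_induction (Q := C.PInv j)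
        (fun _ _ => ih (by omega) (by omega)) (fun _ _ => ih (by omega) (by omega))
        (C.pInv_ep (by omega) le_rfl) h hA hB
    · obtain ⟨e, c⟩ := C.ps_cp hjn hl hl'.1 hl'.2 h
      rw [e]
      exact ih (by omega) hl c hA hB


variable (C : CubicalOmegaCat.{u}) {n : ℕ} {j k l : ℕ} {α β : Bool}

/-- The connections added by ψ_k complete the double connection to ε_{k+2}Γ_k^+X ⋆_{k+1}
ε_{k+2}Γ_k^-X, and the pair Γ_k^+, Γ_k^- cancels. -/
theorem ps_cn_cn (hk : k ≤ n) (X : C.cell (n + 1)) :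
    C.ps k (C.cn (k + 1) (!β) (C.cn k β X)) = C.ep k (C.ep (k + 1) X) := by
  have e : ∀ α, C.cn k α (C.ep (k + 1) X) = C.ep (k + 1 + 1) (C.cn k α X) := fun α =>
    C.cn_ep_lt le_rfl hk X
  have h : C.fc (k + 1) true (C.cn k true X) = C.fc (k + 1) false (C.cn k false X) := by
    rw [C.fc_cn_succ hk, C.fc_cn_succ hk]
  have key : C.cp (k + 1) (C.ep (k + 1 + 1) (C.cn k true X)) (C.ep (k + 1 + 1) (C.cn k false X)) =
      C.ep k (C.ep (k + 1) X) := by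
    rw [← C.ep_cp_gt (by omega) (by omega) _ _ h, C.cn_cp_cn_succ hk,
      C.ep_ep (k := k) (l := k + 1) (by omega) (by omega)]
  rw [← key]
  cases β
  · change C.ps k (C.cn (k + 1) true (C.cn k false X)) = _
    have f₁ : C.fc (k + 1) false (C.cn (k + 1) true (C.cn k false X)) = C.ep (k + 1) X := by
      rw [C.fc_cn_opp (α := false) (β := true) (by omega) rfl, C.fc_cn_succ hk]
    have f₂ : C.fc (k + 1) true (C.cn (k + 1) true (C.cn k false X)) = C.cn k false X :=
      C.fc_cn (by omega) _
    rw [ps, f₁, f₂, C.cp_assoc (by omega), ← C.cn_cn_self hk, C.cn_cp_cn (by omega), e]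
    · rw [C.fc_cn_succ (by omega), f₁]
    · rw [C.fc_cn_succ (by omega), f₂]
  · change C.ps k (C.cn (k + 1) false (C.cn k true X)) = _
    have f₁ : C.fc (k + 1) false (C.cn (k + 1) false (C.cn k true X)) = C.cn k true X :=
      C.fc_cn (by omega) _
    have f₂ : C.fc (k + 1) true (C.cn (k + 1) false (C.cn k true X)) = C.ep (k + 1) X := by
      rw [C.fc_cn_opp (α := true) (β := false) (by omega) rfl, C.fc_cn_succ hk]
    rw [ps, f₁, f₂, ← C.cn_cn_self hk, C.cn_cp_cn (by omega), e]

/-- The outermost index treated, j, is compared with k. For k = j the folding is degenerate; for k +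
1 < j it is again some Γ_k. For j = k + 1 it is a composite of Γ_k and of cells Γ_{k+1}Γ_k: equal
signs give Γ_kΓ_k, opposite signs are settled by `ps_cn_cn`. -/
theorem pInv_cn (hj : j ≤ n + 1) (hk : k < j) (X : C.cell (n + 1)) :
    C.PInv j (C.cn k β X) := by
  induction j using Nat.strong_induction_on generalizing k β X with
  | _ j ih =>
  obtain _ | j := j
  · omega
  rw [PInv]
  have hjn : j ≤ n := by omega
  obtain rfl | rfl | hkj : k = j ∨ j = k + 1 ∨ k + 1 < j := by omega
  · rw [C.ps_cn_self hjn]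
    exact C.pInv_ep (by omega) le_rfl _
  · obtain _ | n := n
    · omega
    refine C.ps_induction hjn (Q := C.PInv (k + 1)) (fun _ _ => PInv.cp C (by omega) (by omega)) ?_
      (ih (k + 1) (by omega) (by omega) (by omega) X)
    intro γ δ
    have hkn : k ≤ n := by omega
    rw [C.fc_cn_gt (by omega) (by omega)]
    obtain rfl | rfl : γ = β ∨ γ = !β := by cases γ <;> cases β <;> simp
    · rw [C.cn_cn_self hkn]
      exact ih (k + 1) (by omega) (by omega) (by omega) _
    · rw [PInv, C.ps_cn_cn hkn]
      exact C.pInv_ep (by omega) le_rfl _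
  · obtain ⟨Y, hY⟩ : ∃ Y, C.ps j (C.cn k β X) = C.cn k β Y := by
      obtain _ | n := n
      · omega
      refine C.ps_induction hjn (Q := fun Z => ∃ Y, Z = C.cn k β Y) ?_ ?_ ⟨_, rfl⟩
      · rintro _ _ h ⟨Y, rfl⟩ ⟨Z, rfl⟩
        rw [C.fc_cn_gt (by omega) (by omega), C.fc_cn_gt (by omega) (by omega)] at h
        have h' := congrArg (C.fc k β) h
        rw [C.fc_cn (by omega), C.fc_cn (by omega)] at h'
        exact ⟨_, (C.cn_cp_lt (by omega) (by omega) _ _ h').symm⟩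
      · intro γ δ
        obtain ⟨j, rfl⟩ : ∃ m, j = m + 1 := ⟨j - 1, by omega⟩
        rw [C.fc_cn_gt (by omega) (by omega), ← C.cn_cn (by omega) (by omega)]
        exact ⟨_, rfl⟩
    rw [hY]
    exact ih j (by omega) (by omega) (by omega) Y

/-! ### Plain invertibility against invertibility in one direction -/

/-- For k ≤ j the folding ψ_j only adds ⋆_k-invertible connections; for k = j + 1 it trades ⋆_{j+1}
for ⋆_j. -/
theorem RInv.pInv (hj : j ≤ n + 1) (hk : k ≤ j) {A : C.cell (n + 2)} (h : C.RInv k A) :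
    C.PInv j A := by
  induction j generalizing k A with
  | zero =>
    obtain rfl : k = 0 := by omega
    exact h
  | succ j ih =>
    rw [PInv]
    have hjn : j ≤ n := by omega
    obtain hk | rfl | rfl : k < j ∨ k = j ∨ k = j + 1 := by omega
    · exact ih (by omega) hk.le (C.ps_induction hjn
        (fun _ _ e h h' => h.cp (by omega) (by omega) e h')
        (fun _ _ => (h.face_gt hk.le hjn).cn_gt hk hjn) h)
    · exact ih (by omega) le_rfl (C.ps_induction hjn
        (fun _ _ e h h' => h.cp (by omega) (by omega) e h')
        (fun _ _ => (h.face_gt le_rfl hjn).cn_self hjn) h)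
    · exact ih (by omega) le_rfl (h.ps_succ C hjn)

/-- The faces of `A` in the directions other than `k` are invertible in the direction of `A` that
is numbered `k`. -/
structure FacesInv (k : ℕ) (A : C.cell (n + 2)) : Prop where
  gt : ∀ l α, k ≤ l → l ≤ n → C.RInv k (C.fc (l + 1) α A)
  -- Removing a direction below k shifts the direction k of A to k - 1 in the face.
  lt : ∀ l m α, k = m + 1 → l ≤ m → C.RInv m (C.fc l α A)

variable {C}

theorem RInv.facesInv (hk : k ≤ n + 1) {A : C.cell (n + 2)} (h : C.RInv k A) :
    C.FacesInv k A where
  gt _ _ hkl hl := h.face_gt hkl hl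
  lt l m α e hl := by
    subst e
    exact h.face_lt hl (by omega)

theorem FacesInv.cp (hk : k ≤ n + 1) (hl : l ≤ n + 1) {A B : C.cell (n + 2)}
    (e : C.fc l true A = C.fc l false B) (hA : C.FacesInv k A) (hB : C.FacesInv k B) :
    C.FacesInv k (C.cp l A B) where
  gt m α hkm hm := by
    obtain h | rfl | h := Nat.lt_trichotomy l (m + 1)
    · have e' : C.fc l true (C.fc (m + 1) α A) = C.fc l false (C.fc (m + 1) α B) := by
        rw [C.fc_fc (by omega) hm, C.fc_fc (by omega) hm, e]
      rw [C.fc_cp_gt (by omega) hm _ _ e]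
      exact (hA.gt m α hkm hm).cp (by omega) (by omega) e' (hB.gt m α hkm hm)
    · cases α
      · rw [C.fc_cp_neg hl _ _ e]
        exact hA.gt _ _ hkm hm
      · rw [C.fc_cp_pos hl _ _ e]
        exact hB.gt _ _ hkm hm
    · obtain ⟨l, rfl⟩ : ∃ m, l = m + 1 := ⟨l - 1, by omega⟩
      have e' : C.fc l true (C.fc (m + 1) α A) = C.fc l false (C.fc (m + 1) α B) := by
        rw [← C.fc_fc (k := m + 1) (l := l) (by omega) (by omega),
          ← C.fc_fc (k := m + 1) (l := l) (by omega) (by omega), e]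
      rw [C.fc_cp_lt (by omega) (by omega) _ _ e]
      exact (hA.gt m α hkm hm).cp (by omega) (by omega) e' (hB.gt m α hkm hm)
  lt p m α hkm hm := by
    obtain h | rfl | h := Nat.lt_trichotomy l p
    · obtain ⟨p, rfl⟩ : ∃ m, p = m + 1 := ⟨p - 1, by omega⟩
      have e' : C.fc l true (C.fc (p + 1) α A) = C.fc l false (C.fc (p + 1) α B) := by
        rw [C.fc_fc (by omega) (by omega), C.fc_fc (by omega) (by omega), e]
      rw [C.fc_cp_gt (by omega) (by omega) _ _ e]
      exact (hA.lt _ m α hkm hm).cp (by omega) (by omega) e' (hB.lt _ m α hkm hm)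
    · cases α
      · rw [C.fc_cp_neg hl _ _ e]
        exact hA.lt _ _ _ hkm hm
      · rw [C.fc_cp_pos hl _ _ e]
        exact hB.lt _ _ _ hkm hm
    · obtain ⟨l, rfl⟩ : ∃ m, l = m + 1 := ⟨l - 1, by omega⟩
      have e' : C.fc l true (C.fc p α A) = C.fc l false (C.fc p α B) := by
        rw [← C.fc_fc (k := p) (l := l) (by omega) (by omega),
          ← C.fc_fc (k := p) (l := l) (by omega) (by omega), e]
      rw [C.fc_cp_lt (by omega) (by omega) _ _ e]
      exact (hA.lt _ m α hkm hm).cp (by omega) (by omega) e' (hB.lt _ m α hkm hm)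

/-- The face of ψ_jA in direction j + 1 is an ε_j; in the directions other than j and j + 1, faces
commute with the folding and `RInv.ps_succ` applies. -/
theorem FacesInv.ps_succ (hj : j ≤ n) {A : C.cell (n + 2)} (h : C.FacesInv (j + 1) A) :
    C.FacesInv j (C.ps j A) where
  gt l α hl hln := by
    obtain rfl | hlt := hl.eq_or_lt
    · obtain ⟨X, hX⟩ := C.fc_ps_succ (α := α) hj A
      rw [hX]
      exact rInv_ep hj X
    · obtain _ | n := n
      · omega
      rw [C.fc_ps_gt hlt hln]
      exact (h.gt l α hlt hln).ps_succ C (by omega)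
  lt l m α e hl := by
    subst e
    obtain _ | n := n
    · omega
    rw [C.fc_ps_lt hl (by omega)]
    exact (h.lt l (m + 1) α rfl (by omega)).ps_succ C (by omega)

/-- Induction gives invertibility of ψ_jA, from which A is rebuilt by composing with connections and
degeneracies of its faces. The hypothesis on faces is what makes these pieces ⋆_k-invertible. For k
= j + 1 the rebuilding starts from `psT j A` instead, reached by exchanging the two directions. -/
theorem PInv.rInv (hj : j ≤ n + 1) (hk : k ≤ j) {A : C.cell (n + 2)} (h : C.PInv j A)
    (hA : C.FacesInv k A) : C.RInv k A := by
  induction j generalizing k A with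
  | zero =>
    obtain rfl : k = 0 := by omega
    exact h
  | succ j ih =>
    rw [PInv] at h
    have hjn : j ≤ n := by omega
    obtain hk | rfl | rfl : k < j ∨ k = j ∨ k = j + 1 := by omega
    · have hc : ∀ α β, C.RInv k (C.cn j α (C.fc (j + 1) β A)) := fun α β =>
        (hA.gt j β hk.le hjn).cn_gt hk hjn
      have hps : C.FacesInv k (C.ps j A) := C.ps_induction hjn
        (fun _ _ e h h' => h.cp (by omega) (by omega) e h')
        (fun α β => (hc α β).facesInv (by omega)) hA
      refine C.of_ps hjn (fun l hl _ _ e h h' => h.cp (by omega) hl e h') hc ?_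
        (ih (by omega) hk.le h hps)
      intro α
      obtain ⟨j, rfl⟩ : ∃ m, j = m + 1 := ⟨j - 1, by omega⟩
      exact (hA.gt j α (by omega) (by omega)).ep_gt (by omega) (by omega)
    · have hc : ∀ α β, C.RInv k (C.cn k α (C.fc (k + 1) β A)) := fun α β =>
        (hA.gt k β le_rfl hjn).cn_self hjn
      have hps : C.FacesInv k (C.ps k A) := C.ps_induction hjn
        (fun _ _ e h h' => h.cp (by omega) (by omega) e h')
        (fun α β => (hc α β).facesInv (by omega)) hA
      exact C.of_ps hjn (fun l hl _ _ e h h' => h.cp (by omega) hl e h') hc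
        (fun α => rInv_ep (by omega) _) (ih (by omega) le_rfl h hps)
    · exact C.of_psT hjn (fun l hl _ _ e h h' => h.cp (by omega) hl e h')
        (fun α β => (hA.lt j j β rfl le_rfl).cn_self_succ hjn)
        (fun α => rInv_ep (by omega) _)
        (C.rInv_psT_of_ps hjn (ih (by omega) le_rfl h (hA.ps_succ hjn)))

/-- Invertibility relative to all foldings passes to and from the transposed folding. -/
theorem pInv_psT_iff (hj : j ≤ n) (A : C.cell (n + 2)) :
    C.PInv (n + 1) (C.psT j A) ↔ C.PInv (n + 1) A :=
  ⟨C.of_psT hj (fun l hl _ _ => PInv.cp C le_rfl hl) (fun _ _ => C.pInv_cn le_rfl (by omega) _)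
      (fun _ => C.pInv_ep le_rfl (by omega) _),
    C.psT_induction hj (fun _ _ => PInv.cp C le_rfl (by omega))
      (fun _ _ => C.pInv_cn le_rfl (by omega) _)⟩

theorem rInv_psT_of_isT (hj : j ≤ n) {A B : C.cell (n + 2)} (h : (C.square n j hj).IsT A B) :
    C.RInv (j + 1) (C.psT j A) :=
  rInv_of_isInv2 hj h.isInv2

theorem exists_isT (hj : j ≤ n) {A : C.cell (n + 2)} (h : C.RInv (j + 1) (C.psT j A)) :
    ∃ B, (C.square n j hj).IsT A B := by
  obtain ⟨B, h⟩ := h.isInv2 hj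
  exact SquareCat.IsInv1.exists_isT _ h

/-- Invertibility of a cell, expressed by the foldings with natural numbers for directions. -/
theorem invertible_iff (A : C.cell (n + 2)) : C.Invertible A ↔ C.PInv (n + 1) A := by
  -- `PInv` applies the folding of highest index first, which is the last entry of the range.
  have h₁ : ∀ (j : ℕ) (A : C.cell (n + 2)),
      C.PInv j A ↔ C.RInv 0 ((List.range j).foldr C.ps A) := by
    intro j
    induction j with
    | zero => exact fun A => Iff.rfl
    | succ j ih =>
      intro A
      rw [PInv, ih, List.range_succ, List.foldr_append]
      rfl
  have h₂ : ∀ (i : Fin (n + 1)) (A : C.cell (n + 2)), C.psi i A = C.ps i A := by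
    intro i A
    simp only [psi, cp_eq', cn_eq', fc_eq', Fin.val_succ]
    rfl
  have h₃ : C.fold A = (List.range (n + 1)).foldr C.ps A := by
    have : C.psi = fun (i : Fin (n + 1)) => C.ps (n := n) i := by
      funext i A
      exact h₂ i A
    rw [fold, ← List.map_coe_finRange_eq_range, List.foldr_map, this]
  rw [h₁, ← h₃, Invertible, RInvertible]
  refine exists_congr fun B => ⟨?_, ?_⟩
  · rintro ⟨e, e', h, h'⟩
    rw [cp_eq'] at h h'
    exact ⟨e, e', h, h'⟩
  · rintro ⟨e, e', h, h'⟩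
    exact ⟨e, e', (C.cp_eq' 0 _ _ e).trans h, (C.cp_eq' 0 _ _ e').trans h'⟩

end CubicalOmegaCat

/-! ### T-inverses in the cubical category and in the double category -/

namespace SquareCat

variable {V E S : Type u} (D : SquareCat V E S)

/-- Composability of the outer composites follows from the face conditions on A and B; `TEq` uses
total compositions and does not record it. -/
theorem tEq_composable (A B : S) (h₂ : D.t1 A = D.t2 B)
    (h₃ : D.s2 A = D.s1 B) (h₄ : D.t2 A = D.t1 B) :
    D.t2 (D.c1 (D.gp (D.s1 B)) B) = D.s2 (D.c1 A (D.gm (D.t1 A))) ∧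
      D.t1 (D.gm (D.s1 A)) = D.s1 (D.gp (D.t1 B)) := by
  constructor
  · rw [D.t2_c1 _ _ (D.t1_gp _), D.s2_c1 _ _ (D.s1_gm _).symm, D.t2_gp, D.s2_gm, h₂, h₃]
  · rw [D.t1_gm, D.s1_gp, D.tgt_s1, h₄]

end SquareCat

namespace CubicalOmegaCat

variable {C : CubicalOmegaCat.{u}} {n : ℕ} {k l : ℕ} {α β : Bool}

theorem tEquation_iff (i : Fin (n + 1)) (A B : C.cell (n + 2))
    (h₁ : ∀ α, C.face i.castSucc α A = C.face i.succ α B)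
    (h₂ : ∀ α, C.face i.succ α A = C.face i.castSucc α B) :
    (C.layer n).TEquation i A B ↔ (C.square n i (by omega)).TEq A B := by
  have hi : (i : ℕ) ≤ n := by omega
  have e₁ : ∀ α, C.fc i α A = C.fc (i + 1) α B := fun α => by
    simpa only [fc_eq', Fin.val_castSucc, Fin.val_succ] using h₁ α
  have e₂ : ∀ α, C.fc (i + 1) α A = C.fc i α B := fun α => by
    simpa only [fc_eq', Fin.val_castSucc, Fin.val_succ] using h₂ α
  have hc := (C.square n i hi).tEq_composable A B (e₁ _) (e₂ _) (e₂ _)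
  change _ ↔ C.cp (i + 1) (C.cp i (C.cn i true (C.fc i false B)) B)
    (C.cp i A (C.cn i false (C.fc i true A))) =
      C.cp i (C.cn i false (C.fc i false A)) (C.cn i true (C.fc i true B))
  simp only [Layer.TEquation, layer]
  constructor
  · rintro ⟨k₁, k₂, k₃, k₄, h⟩
    simpa only [cp_eq', fc_eq', cn_eq', Fin.val_castSucc, Fin.val_succ] using h
  · intro h
    have k₁ := C.face_conn_self i true (C.face i.castSucc false B)
    have k₂ := (C.face_conn_self i false (C.face i.castSucc true A)).symm
    have k₃ : C.face i.succ true (C.comp i.castSucc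
          (C.conn i true (C.face i.castSucc false B)) B k₁) =
        C.face i.succ false (C.comp i.castSucc A
          (C.conn i false (C.face i.castSucc true A)) k₂) := by
      simp only [cp_eq', fc_eq', cn_eq', Fin.val_castSucc, Fin.val_succ]
      exact hc.1
    have k₄ : C.face i.castSucc true (C.conn i false (C.face i.castSucc false A)) =
        C.face i.castSucc false (C.conn i true (C.face i.castSucc true B)) := by
      simp only [fc_eq', cn_eq', Fin.val_castSucc]
      exact hc.2
    refine ⟨k₁, k₂, k₃, k₄, ?_⟩
    simpa only [cp_eq', fc_eq', cn_eq', Fin.val_castSucc, Fin.val_succ] using h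

theorem isTInverse_iff (i : Fin (n + 1)) (A B : C.cell (n + 2)) :
    (C.layer n).IsTInverse i A B ↔ (C.square n i (by omega)).IsT A B := by
  constructor
  · rintro ⟨h₁, h₂, h, h'⟩
    have e₁ : ∀ α, C.fc i α A = C.fc (i + 1) α B := fun α => by
      simpa only [layer, fc_eq', Fin.val_castSucc, Fin.val_succ] using h₁ α
    have e₂ : ∀ α, C.fc (i + 1) α A = C.fc i α B := fun α => by
      simpa only [layer, fc_eq', Fin.val_castSucc, Fin.val_succ] using h₂ α
    exact ⟨e₁ _, e₁ _, e₂ _, e₂ _, (tEquation_iff i A B h₁ h₂).1 h,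
      (tEquation_iff i B A (fun α => (h₂ α).symm) fun α => (h₁ α).symm).1 h'⟩
  · rintro ⟨e₁, e₂, e₃, e₄, h, h'⟩
    have h₁ : ∀ α, C.face i.castSucc α A = C.face i.succ α B := by
      simp only [fc_eq', Fin.val_castSucc, Fin.val_succ]
      rintro (_ | _)
      exacts [e₁, e₂]
    have h₂ : ∀ α, C.face i.succ α A = C.face i.castSucc α B := by
      simp only [fc_eq', Fin.val_castSucc, Fin.val_succ]
      rintro (_ | _)
      exacts [e₃, e₄]
    exact ⟨h₁, h₂, (tEquation_iff i A B h₁ h₂).2 h,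
      (tEquation_iff i B A (fun α => (h₂ α).symm) fun α => (h₁ α).symm).2 h'⟩

/-! ### Shells and their sides -/

theorem Shell.comp_congr (i : Fin (n + 2)) {S S' T T' : C.Shell n} (hS : S = T) (hS' : S' = T')
    (h : S.side i true = S'.side i false) (h' : T.side i true = T'.side i false) :
    Shell.comp i S S' h = Shell.comp i T T' h' := by
  subst hS hS'
  rfl

theorem shell_comp (i : Fin (n + 2)) (A B : C.cell (n + 2))
    (h : C.face i true A = C.face i false B) :
    Shell.comp i (shell A) (shell B) h = shell (C.comp i A B h) := by
  ext j α
  change Shell.compSide i (shell A) (shell B) h j α = C.face j α (C.comp i A B h)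
  unfold Shell.compSide
  split_ifs with hij hα
  · subst hij hα
    exact (C.face_comp_pos i A B h).symm
  · subst hij
    obtain rfl : α = false := by simpa using hα
    exact (C.face_comp_neg i A B h).symm
  · exact (C.face_comp j i (Ne.symm hij) α A B h _).symm

theorem shell_tEquation (i : Fin (n + 1)) {A B : C.cell (n + 2)}
    (h : (C.layer n).TEquation i A B) : (C.boxLayer n).TEquation i (shell A) (shell B) := by
  obtain ⟨h₁, h₂, h₃, h₄, h⟩ := h
  have e₁ := shell_comp i.castSucc _ _ h₁
  have e₂ := shell_comp i.castSucc _ _ h₂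
  have e₃ := shell_comp i.succ _ _ h₃
  have e₄ := shell_comp i.castSucc _ _ h₄
  refine ⟨h₁, h₂, ?_, h₄, ?_⟩
  · exact (congrArg (fun S => S.side i.succ true) e₁).trans
      (Eq.trans h₃ (congrArg (fun S => S.side i.succ false) e₂).symm)
  · refine Eq.trans ?_ ((congrArg shell h).trans e₄.symm)
    exact Eq.trans (Shell.comp_congr _ e₁ e₂ _ h₃) e₃

/-- The shell of a `T_i`-invertible cell is `T_i`-invertible. -/
theorem shell_tInvertible (i : Fin (n + 1)) {A : C.cell (n + 2)} (h : C.TInvertible i A) :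
    C.HasTInvertibleShell i A := by
  obtain ⟨B, h₁, h₂, h, h'⟩ := h
  exact ⟨shell B, h₁, h₂, shell_tEquation i h, shell_tEquation i h'⟩

/-- The sides of a shell, with a natural number for the direction. -/
def sd (S : C.Shell n) (k : ℕ) (α : Bool) : C.cell (n + 1) := S.side (Fin.ofNat (n + 2) k) α

theorem sd_eq' (S : C.Shell n) (i : Fin (n + 2)) (α : Bool) : S.side i α = sd S i α := by
  rw [sd, ofNat_eq i.2]

theorem sd_shell (A : C.cell (n + 2)) : sd (shell A) k α = C.fc k α A := rfl

theorem fc_sd (hkl : k ≤ l) (hl : l ≤ n) (S : C.Shell n) :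
    C.fc k α (sd S (l + 1) β) = C.fc l β (sd S k α) := by
  have hn : (⟨k, by omega⟩ : Fin (n + 2)) ≠ ⟨l + 1, by omega⟩ := by simp; omega
  have := S.compat _ _ hn α β
  rw [low_of_lt hn (Nat.lt_succ_of_le hkl), low_of_gt hn.symm (Nat.lt_succ_of_le hkl)] at this
  simpa only [fc_eq', sd_eq', Nat.add_sub_cancel] using this

theorem sd_comp_gt (i : Fin (n + 2)) (hkl : (i : ℕ) ≤ k) (hk : k ≤ n) (S S' : C.Shell n)
    (h : S.side i true = S'.side i false) :
    sd (Shell.comp i S S' h) (k + 1) α = C.cp i (sd S (k + 1) α) (sd S' (k + 1) α) := by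
  have hn : i ≠ ⟨k + 1, by omega⟩ := by simp [Fin.ext_iff]; omega
  rw [sd, ofNat_eq (by omega)]
  change Shell.compSide i S S' h _ α = _
  unfold Shell.compSide
  rw [dif_neg hn, cp_eq', sd_eq', sd_eq', low_of_lt hn (Nat.lt_succ_of_le hkl)]

theorem sd_comp_lt (i : Fin (n + 2)) (hil : (i : ℕ) = l + 1) (hkl : k ≤ l) (S S' : C.Shell n)
    (h : S.side i true = S'.side i false) :
    sd (Shell.comp i S S' h) k α = C.cp l (sd S k α) (sd S' k α) := by
  have hn : i ≠ ⟨k, by omega⟩ := by simp [Fin.ext_iff]; omega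
  rw [sd, ofNat_eq (by omega)]
  change Shell.compSide i S S' h _ α = _
  unfold Shell.compSide
  rw [dif_neg hn, cp_eq', sd_eq', sd_eq', low_of_gt hn (show k < (i : ℕ) by omega)]
  simp [hil]

/-- Sides in directions beyond i + 1 commute with all the operations in the equation, so each side
inherits it, with the same i. -/
theorem tEq_sd_gt (i : Fin (n + 2)) (hk : (i : ℕ) < k) (hkn : k ≤ n + 1) {S S' : C.Shell (n + 1)}
    (h : (C.boxLayer (n + 1)).TEquation i S S') :
    (C.square n i (by omega)).TEq (sd S (k + 1) α) (sd S' (k + 1) α) := by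
  obtain ⟨h₁, h₂, h₃, h₄, h⟩ := h
  have e := congrArg (fun T => sd T (k + 1) α) h
  simp only [boxLayer] at e
  rw [sd_comp_gt _ (by simp; omega) hkn, sd_comp_gt _ (by simp; omega) hkn,
    sd_comp_gt _ (by simp; omega) hkn, sd_comp_gt _ (by simp; omega) hkn] at e
  simp only [sd_shell, cn_eq', sd_eq', Fin.val_castSucc, Fin.val_succ] at e
  rw [C.fc_cn_gt hk hkn, C.fc_cn_gt hk hkn, C.fc_cn_gt hk hkn, C.fc_cn_gt hk hkn] at e
  simp only [← fc_sd (k := i) (l := k) hk.le hkn] at e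
  exact e

/-- As above for directions below i, where removing the direction lowers i by one. -/
theorem tEq_sd_lt (i : Fin (n + 2)) (hi : (i : ℕ) = l + 1) (hk : k ≤ l) {S S' : C.Shell (n + 1)}
    (h : (C.boxLayer (n + 1)).TEquation i S S') :
    (C.square n l (by omega)).TEq (sd S k α) (sd S' k α) := by
  have hl : l ≤ n := by omega
  obtain ⟨h₁, h₂, h₃, h₄, h⟩ := h
  have e := congrArg (fun T => sd T k α) h
  simp only [boxLayer] at e
  rw [sd_comp_lt (l := l + 1) _ (by simp; omega) (by omega),
    sd_comp_lt (l := l) _ (by simp; omega) (by omega),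
    sd_comp_lt (l := l) _ (by simp; omega) (by omega),
    sd_comp_lt (l := l) _ (by simp; omega) (by omega)] at e
  simp only [sd_shell, cn_eq', sd_eq', Fin.val_castSucc, hi] at e
  rw [C.fc_cn_lt hk hl, C.fc_cn_lt hk hl, C.fc_cn_lt hk hl, C.fc_cn_lt hk hl,
    fc_sd (by omega) (by omega), fc_sd (by omega) (by omega), fc_sd (by omega) (by omega),
    fc_sd (by omega) (by omega)] at e
  exact e

theorem isT_sd_gt (i : Fin (n + 2)) (hk : (i : ℕ) < k) (hkn : k ≤ n + 1) {S S' : C.Shell (n + 1)}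
    (h : (C.boxLayer (n + 1)).IsTInverse i S S') :
    (C.square n i (by omega)).IsT (sd S (k + 1) α) (sd S' (k + 1) α) := by
  obtain ⟨h₁, h₂, h, h'⟩ := h
  have e₁ : ∀ β, C.fc i β (sd S (k + 1) α) = C.fc (i + 1) β (sd S' (k + 1) α) := fun β => by
    have := h₁ β
    simp only [boxLayer, sd_eq', Fin.val_castSucc, Fin.val_succ] at this
    rw [fc_sd (k := i) (by omega) hkn, fc_sd (k := i + 1) (by omega) hkn, this]
  have e₂ : ∀ β, C.fc (i + 1) β (sd S (k + 1) α) = C.fc i β (sd S' (k + 1) α) := fun β => by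
    have := h₂ β
    simp only [boxLayer, sd_eq', Fin.val_castSucc, Fin.val_succ] at this
    rw [fc_sd (k := i + 1) (by omega) hkn, fc_sd (k := i) (by omega) hkn, this]
  exact ⟨e₁ _, e₁ _, e₂ _, e₂ _, tEq_sd_gt i hk hkn h, tEq_sd_gt i hk hkn h'⟩

theorem isT_sd_lt (i : Fin (n + 2)) (hi : (i : ℕ) = l + 1) (hk : k ≤ l) {S S' : C.Shell (n + 1)}
    (h : (C.boxLayer (n + 1)).IsTInverse i S S') :
    (C.square n l (by omega)).IsT (sd S k α) (sd S' k α) := by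
  obtain ⟨h₁, h₂, h, h'⟩ := h
  have e₁ : ∀ β, C.fc l β (sd S k α) = C.fc (l + 1) β (sd S' k α) := fun β => by
    have := h₁ β
    simp only [boxLayer, sd_eq', Fin.val_castSucc, Fin.val_succ, hi] at this
    rw [← fc_sd (l := l) hk (by omega), ← fc_sd (l := l + 1) (by omega) (by omega), this]
  have e₂ : ∀ β, C.fc (l + 1) β (sd S k α) = C.fc l β (sd S' k α) := fun β => by
    have := h₂ β
    simp only [boxLayer, sd_eq', Fin.val_castSucc, Fin.val_succ, hi] at this
    rw [← fc_sd (l := l + 1) (by omega) (by omega), ← fc_sd (l := l) hk (by omega), this]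
  exact ⟨e₁ _, e₁ _, e₂ _, e₂ _, tEq_sd_lt i hi hk h, tEq_sd_lt i hi hk h'⟩

/-- The excluded direction is i + 1, and the face in direction i is an ε_i. The other faces are
transposed foldings of faces of A, whose T-inverses are the corresponding sides of the inverse
shell. -/
theorem facesInv_psT (i : Fin (n + 1)) {A : C.cell (n + 2)} (h : C.HasTInvertibleShell i A) :
    C.FacesInv (i + 1) (C.psT i A) := by
  obtain ⟨S, h⟩ := h
  have hi : (i : ℕ) ≤ n := by omega
  constructor
  · intro l α hl hln
    obtain _ | n := n
    · omega
    rw [C.fc_psT_gt hl hln]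
    exact rInv_psT_of_isT (by omega) (isT_sd_gt (α := α) i hl hln h)
  · intro l m α e hl
    obtain rfl : (i : ℕ) = m := by omega
    obtain rfl | hlt := hl.eq_or_lt
    · obtain ⟨X, hX⟩ := C.fc_psT_self (α := α) hi A
      rw [hX]
      exact rInv_ep hi X
    · obtain _ | n := n
      · omega
      obtain ⟨m, hm⟩ : ∃ m, (i : ℕ) = m + 1 := ⟨i - 1, by omega⟩
      rw [hm, C.fc_psT_lt (by omega) (by omega)]
      exact rInv_psT_of_isT (by omega) (isT_sd_lt (α := α) i hm (by omega) h)

end CubicalOmegaCat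

end Cubical

theorem proposition3p3p5 (C : Cubical.CubicalOmegaCat.{u}) (n : ℕ) (A : C.cell (n + 2))
    (i : Fin (n + 1)) :
    C.TInvertible i A ↔ C.Invertible A ∧ C.HasTInvertibleShell i A := by
  have hi : (i : ℕ) ≤ n := by omega
  -- Plain invertibility is moved from A to `psT i A`, the cell whose ⋆_{i+1}-invertibility is
  -- T_i-invertibility of A.
  rw [Cubical.CubicalOmegaCat.invertible_iff, ← Cubical.CubicalOmegaCat.pInv_psT_iff hi]
  constructor
  · intro h
    refine ⟨?_, Cubical.CubicalOmegaCat.shell_tInvertible i h⟩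
    obtain ⟨B, h⟩ := h
    exact (Cubical.CubicalOmegaCat.rInv_psT_of_isT hi
      ((Cubical.CubicalOmegaCat.isTInverse_iff i A B).1 h)).pInv C le_rfl (by omega)
  · rintro ⟨h, hS⟩
    obtain ⟨B, hB⟩ := Cubical.CubicalOmegaCat.exists_isT hi
      (h.rInv le_rfl (by omega) (Cubical.CubicalOmegaCat.facesInv_psT i hS))
    exact ⟨B, (Cubical.CubicalOmegaCat.isTInverse_iff i A B).2 hB⟩
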